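/- There are an algorithm and a constant $C$ such that the following holds. Given a caterpillar $T$ with $n$ vertices (that is, a tree containing a path on which all vertices of degree at least $3$ lie) and a positive integer $b$, the algorithm stops after at most $C\,b\,n^3$ steps and either returns a layout $\alpha$ of $T$ (a bijection $\alpha : V(T) \to \{1,\dots,n\}$) with bandwidth $\mathrm{bw}(T,\alpha) = \max_{uv \in E(T)} |\alpha(u)-\alpha(v)| \le 48b^3$, or correctly concludes that $\mathrm{bw}(T) > b$, where $\mathrm{bw}(T)$ is the minimum of $\mathrm{bw}(T,\alpha)$ over all layouts $\alpha$ of $T$. (An algorithm is a program for a random access machine with words of $O(\log(n+b))$ bits; the tree is given by its adjacency matrix.) -/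

import Mathlib

/-! ## Caterpillars, layouts and bandwidth -/

open Classical in
/-- A caterpillar: a tree with a path (the backbone) that contains every vertex of degree at
least three. -/
def IsCaterpillar {V : Type*} [Fintype V] (G : SimpleGraph V) : Prop :=
  G.IsTree ∧ ∃ (u v : V) (B : G.Walk u v), B.IsPath ∧ ∀ w : V, 3 ≤ G.degree w → w ∈ B.support

/-- A layout (linear ordering) of `V`: a bijection from `V` onto `{1, …, |V|}`. -/
def IsLayout {V : Type*} [Fintype V] (α : V → ℕ) : Prop :=
  Set.BijOn α Set.univ (Set.Icc 1 (Fintype.card V))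

open Classical in
/-- The bandwidth of an ordering `α` of a graph: the maximum of `|α u - α v|` over the edges `uv`
(and `0` if there are no edges). -/
noncomputable def layoutBandwidth {V : Type*} [Fintype V] (G : SimpleGraph V) (α : V → ℕ) : ℕ :=
  Finset.univ.sup fun p : V × V =>
    if G.Adj p.1 p.2 then ((α p.1 : ℤ) - (α p.2 : ℤ)).natAbs else 0

/-- The bandwidth of a graph: the minimum bandwidth of a layout (a layout always exists). -/
noncomputable def bandwidth {V : Type*} [Fintype V] (G : SimpleGraph V) : ℕ :=
  sInf {k : ℕ | ∃ α : V → ℕ, IsLayout α ∧ layoutBandwidth G α = k}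

/-! ## Machine model: word RAM programs

A program is a finite term. It works on scalar variables `0, 1, 2, …` and on random-access arrays
`0, 1, 2, …` of natural numbers; a fixed program mentions only finitely many variables and arrays.
Every arithmetic operation, comparison, array access, constant, variable access, assignment, write
and test costs one step. No number larger than the word bound `W` may occur anywhere in the
computation. -/

namespace WordRAM

/-- The memory: `var x` is the value of variable `x`, `arr a i` is the cell `i` of array `a`. -/
structure State where
  var : ℕ → ℕ
  arr : ℕ → ℕ → ℕ

/-- The primitive operations on words; subtraction is truncated at zero. -/
inductive Op where
  | add
  | sub
  | mul
  | lt
  | eq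

def Op.apply : Op → ℕ → ℕ → ℕ
  | .add, x, y => x + y
  | .sub, x, y => x - y
  | .mul, x, y => x * y
  | .lt, x, y => if x < y then 1 else 0
  | .eq, x, y => if x = y then 1 else 0

/-- Expressions: constants, variables, array accesses, and operations. -/
inductive Expr where
  | const (k : ℕ)
  | var (x : ℕ)
  | get (a : ℕ) (i : Expr)
  | op (o : Op) (e₁ e₂ : Expr)

/-- The value of an expression. -/
def Expr.value (s : State) : Expr → ℕ
  | .const k => k
  | .var x => s.var x
  | .get a i => s.arr a (i.value s)
  | .op o e₁ e₂ => o.apply (e₁.value s) (e₂.value s)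

/-- The number of steps needed to evaluate an expression: one for each of its nodes. -/
def Expr.cost : Expr → ℕ
  | .const _ => 1
  | .var _ => 1
  | .get _ i => i.cost + 1
  | .op _ e₁ e₂ => e₁.cost + e₂.cost + 1

/-- All numbers (array indices included) that occur in the evaluation are at most `W`. -/
def Expr.Fits (W : ℕ) (s : State) : Expr → Prop
  | .const k => k ≤ W
  | .var x => s.var x ≤ W
  | .get a i => i.Fits W s ∧ s.arr a (i.value s) ≤ W
  | .op o e₁ e₂ => e₁.Fits W s ∧ e₂.Fits W s ∧ o.apply (e₁.value s) (e₂.value s) ≤ W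

/-- Programs (`loop e c` repeats `c` as long as the test `e` succeeds); a test succeeds if its value is not zero. -/
inductive Prog where
  | skip
  | assign (x : ℕ) (e : Expr)
  | store (a : ℕ) (i e : Expr)
  | seq (c d : Prog)
  | ite (e : Expr) (c d : Prog)
  | loop (e : Expr) (c : Prog)

/-- `Exec W c s t s'`: with word bound `W`, the program `c` started in the memory `s` stops after
exactly `t` steps in the memory `s'`, and no number exceeds `W` on the way. -/
inductive Exec (W : ℕ) : Prog → State → ℕ → State → Prop
  | skip (s : State) : Exec W .skip s 1 s
  | assign (s : State) (x : ℕ) (e : Expr) (he : e.Fits W s) :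
      Exec W (.assign x e) s (e.cost + 1)
        { s with var := Function.update s.var x (e.value s) }
  | store (s : State) (a : ℕ) (i e : Expr) (hi : i.Fits W s) (he : e.Fits W s) :
      Exec W (.store a i e) s (i.cost + e.cost + 1)
        { s with arr := Function.update s.arr a
                          (Function.update (s.arr a) (i.value s) (e.value s)) }
  | seq (c d : Prog) (s s' s'' : State) (t t' : ℕ)
      (hc : Exec W c s t s') (hd : Exec W d s' t' s'') :
      Exec W (.seq c d) s (t + t') s''
  | ite_true (e : Expr) (c d : Prog) (s s' : State) (t : ℕ) (he : e.Fits W s)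
      (h : e.value s ≠ 0) (hc : Exec W c s t s') :
      Exec W (.ite e c d) s (e.cost + 1 + t) s'
  | ite_false (e : Expr) (c d : Prog) (s s' : State) (t : ℕ) (he : e.Fits W s)
      (h : e.value s = 0) (hd : Exec W d s t s') :
      Exec W (.ite e c d) s (e.cost + 1 + t) s'
  | loop_true (e : Expr) (c : Prog) (s s' s'' : State) (t t' : ℕ) (he : e.Fits W s)
      (h : e.value s ≠ 0) (hc : Exec W c s t s') (hw : Exec W (.loop e c) s' t' s'') :
      Exec W (.loop e c) s (e.cost + 1 + t + t') s''
  | loop_false (e : Expr) (c : Prog) (s : State) (he : e.Fits W s) (h : e.value s = 0) :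
      Exec W (.loop e c) s (e.cost + 1) s

open Classical in
/-- The memory that holds the input `(T, b)`: variable `0` is the number `n` of vertices,
variable `1` is `b`, array `0` is the adjacency matrix of `T`, with the entry for the pair `(u, v)`
in cell `u * n + v`, and everything else is zero. -/
noncomputable def inputState {n : ℕ} (T : SimpleGraph (Fin n)) (b : ℕ) : State where
  var x := if x = 0 then n else if x = 1 then b else 0
  arr a i := if a = 0 ∧ ∃ u v : Fin n, T.Adj u v ∧ i = (u : ℕ) * n + (v : ℕ) then 1 else 0

end WordRAM

/-!
The algorithm takes as backbone the path between two vertices of degree at least three that are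
farthest apart, and lays out the backbone from left to right, one vertex per bucket. Each hair, a path
attached to the backbone, is folded along the backbone to the left or to the right with `4 * b`
vertices per bucket. A layout that lists the buckets one after the other has bandwidth less than twice
the size of the largest bucket, so only the directions of the hairs matter.

The direction is chosen by the depth of the hair. The hair of `w` reaches `reach w` buckets to either
side. Its depth is one more than the minimum of `rightDepth` and `leftDepth`, the maximal depths of
the combs of shorter hairs that lie entirely within twice its reach on its right and on its left; it is
folded to the side where this maximum is smaller.

* Depth is a lower bound for the bandwidth (`HairedPath.depth_le`). By induction, in any ordering with
  bandwidth at most `b`, a comb of depth `k` has `k` vertices among `b` consecutive positions that end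
  at a backbone vertex. The two combs on both sides of a hair of depth `k + 1` supply two such windows.
  The hair is too long to stay between them. So either the hair or the path from its foot to one of the
  combs meets the window of the other comb, and is disjoint from that comb
  (`HairedPath.exists_window_of_lt_depth`).
* Consider the hairs that are folded to the right and meet a given bucket, and let `v` be one with the
  smallest reach. Those attached within `3 * reach v` of the bucket are at most `2 * b` in number, as
  many long hairs close together force a large bandwidth (`HairedPath.card_image_root_mul_le`). All the
  others have the comb of `v` entirely on their right, and therefore a larger depth. Hence if the
  bandwidth is at most `b`, there are at most `b` such groups (`card_le_depth_mul`), and a bucket has at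
  most `8 * b ^ 3` vertices for each direction and one backbone vertex
  (`HairedPath.card_bucket_eq_le`). This gives bandwidth at most `32 * b ^ 3 + 1`.

The program computes this layout and checks its bandwidth. If the check fails, the bandwidth of the tree
exceeds `b`. Distances are computed by the algorithm of Floyd and Warshall, and positions, heights and
hairs are read off from the distances.

The program is written in a small language of bounded loops and aggregates (`LoopLang.Term`,
`LoopLang.Stmt`), whose compiler to the word RAM is verified once: the running time is
`O(n ^ height)`, where `height` is the nesting depth of the loops, and all words are polynomial in
`n + b` (`LoopLang.Stmt.runs_compile`).
-/

namespace LoopLang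

open WordRAM

/-! ### A language of bounded loops and its compiler -/

/-- Accumulation modes of an aggregate over `i < N`. -/
inductive Agg where
  | sum
  | sup

/-- One accumulation step; `acc + (v - acc)` is the maximum, as subtraction is truncated. -/
def Agg.step : Agg → ℕ → ℕ → ℕ
  | .sum, acc, v => acc + v
  | .sup, acc, v => acc + (v - acc)

/-- The machine expression for a step, with the accumulator in register `k` and the new value in
register `k + 2`. -/
def Agg.expr (k : ℕ) : Agg → Expr
  | .sum => .op .add (.var k) (.var (k + 2))
  | .sup => .op .add (.var k) (.op .sub (.var (k + 2)) (.var k))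

/-- Terms with bounded aggregates: `agg g x e` is the sum or the maximum of `e` over all values
`x < N` of the bound variable `x`, where `N` is the size of the input. -/
inductive Term where
  | const (k : ℕ)
  | var (x : ℕ)
  | get (a : ℕ) (i : Term)
  | op (o : Op) (e f : Term)
  | agg (g : Agg) (x : ℕ) (e : Term)

/-- The value of a term for arrays `A` and an assignment `env` of the variables. -/
def Term.val (N : ℕ) (A : ℕ → ℕ → ℕ) : Term → (ℕ → ℕ) → ℕ
  | .const k, _ => k
  | .var x, env => env x
  | .get a i, env => A a (i.val N A env)
  | .op o e f, env => o.apply (e.val N A env) (f.val N A env)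
  | .agg g x e, env =>
      Nat.rec 0 (fun i acc => g.step acc (e.val N A (Function.update env x i))) N

/-- Machine code that leaves the value of a term in register `k` and changes no register below `k`.
The variable `x` is held in register `ρ x`, and register `0` holds the loop bound. -/
def Term.compile : Term → (ℕ → ℕ) → ℕ → Prog
  | .const c, _, k => .assign k (.const c)
  | .var x, ρ, k => .assign k (.var (ρ x))
  | .get a i, ρ, k => .seq (i.compile ρ k) (.assign k (.get a (.var k)))
  | .op o e f, ρ, k =>
      .seq (e.compile ρ k) (.seq (f.compile ρ (k + 1))
        (.assign k (.op o (.var k) (.var (k + 1)))))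
  | .agg g x e, ρ, k =>
      .seq (.assign k (.const 0)) (.seq (.assign (k + 1) (.const 0))
        (.loop (.op .lt (.var (k + 1)) (.var 0))
          (.seq (e.compile (Function.update ρ x (k + 1)) (k + 2))
            (.seq (.assign k (g.expr k))
              (.assign (k + 1) (.op .add (.var (k + 1)) (.const 1)))))))

/-- The exponent of `N` in the running time of a term. -/
def Term.height : Term → ℕ
  | .const _ => 0
  | .var _ => 0
  | .get _ i => i.height
  | .op _ e f => max e.height f.height
  | .agg _ _ e => e.height + 1

/-- The constant factor in the running time of a term. -/
def Term.size : Term → ℕ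
  | .const _ => 2
  | .var _ => 2
  | .get _ i => i.size + 3
  | .op _ e f => e.size + f.size + 4
  | .agg _ _ e => e.size + 22

/-- An exponent such that the values of a term and of its subterms are at most `X ^ deg`,
if `X` bounds the input, the arrays and the constants. -/
def Term.deg : Term → ℕ
  | .const _ => 1
  | .var _ => 1
  | .get _ i => i.deg
  | .op _ e f => e.deg + f.deg
  | .agg _ _ e => e.deg + 1

/-- A bound for the constants that occur in a term. -/
def Term.maxConst : Term → ℕ
  | .const k => k
  | .var _ => 0
  | .get _ i => i.maxConst
  | .op _ e f => max e.maxConst f.maxConst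
  | .agg _ _ e => e.maxConst

/-- Whether a term reads array `a`. -/
def Term.reads (a : ℕ) : Term → Bool
  | .const _ => false
  | .var _ => false
  | .get a' i => a' == a || i.reads a
  | .op _ e f => e.reads a || f.reads a
  | .agg _ _ e => e.reads a

/-- Statements: `store a i e` writes `min e (8 * N)` into cell `i` of array `a`, and `loop x c` runs
`c` for `x = 0, …, N - 1`. Clamping the stored values keeps all words polynomial, whatever the
terms are. -/
inductive Stmt where
  | store (a : ℕ) (i e : Term)
  | seq (c d : Stmt)
  | loop (x : ℕ) (c : Stmt)

/-- The arrays after the execution of a statement. -/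
def Stmt.run (N : ℕ) : Stmt → (ℕ → ℕ) → (ℕ → ℕ → ℕ) → (ℕ → ℕ → ℕ)
  | .store a i e, env, A =>
      Function.update A a (Function.update (A a) (i.val N A env) (min (e.val N A env) (8 * N)))
  | .seq c d, env, A => d.run N env (c.run N env A)
  | .loop x c, env, A => Nat.rec A (fun i A' => c.run N (Function.update env x i) A') N

/-- Machine code for a statement that changes no register below `k`. -/
def Stmt.compile : Stmt → (ℕ → ℕ) → ℕ → Prog
  | .store a i e, ρ, k =>
      .seq (i.compile ρ k) (.seq (e.compile ρ (k + 1))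
        (.store a (.var k) (.op .sub (.var (k + 1))
          (.op .sub (.var (k + 1)) (.op .mul (.const 8) (.var 0))))))
  | .seq c d, ρ, k => .seq (c.compile ρ k) (d.compile ρ k)
  | .loop x c, ρ, k =>
      .seq (.assign k (.const 0))
        (.loop (.op .lt (.var k) (.var 0))
          (.seq (c.compile (Function.update ρ x k) (k + 1))
              (.assign k (.op .add (.var k) (.const 1)))))

/-- The exponent of `N` in the running time of a statement. -/
def Stmt.height : Stmt → ℕ
  | .store _ i e => max i.height e.height
  | .seq c d => max c.height d.height
  | .loop _ c => c.height + 1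

/-- The constant factor in the running time of a statement. -/
def Stmt.size : Stmt → ℕ
  | .store _ i e => i.size + e.size + 9
  | .seq c d => c.size + d.size
  | .loop _ c => c.size + 14

/-- An exponent that bounds the values in a statement; see `Term.deg`. -/
def Stmt.deg : Stmt → ℕ
  | .store _ i e => max i.deg e.deg
  | .seq c d => max c.deg d.deg
  | .loop _ c => c.deg

/-- A bound for the constants that occur in a statement. -/
def Stmt.maxConst : Stmt → ℕ
  | .store _ i e => max i.maxConst e.maxConst
  | .seq c d => max c.maxConst d.maxConst
  | .loop _ c => c.maxConst

/-! ### Running compiled code -/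

/-- From `s`, the program `c` stops within `B` steps in a memory that satisfies `Q`. -/
def Runs (W : ℕ) (c : Prog) (s : State) (B : ℕ) (Q : State → Prop) : Prop :=
  ∃ t s', Exec W c s t s' ∧ t ≤ B ∧ Q s'

theorem Runs.mono {W : ℕ} {c : Prog} {s : State} {B B' : ℕ} {Q Q' : State → Prop}
    (h : Runs W c s B Q) (hB : B ≤ B') (hQ : ∀ s', Q s' → Q' s') : Runs W c s B' Q' := by
  obtain ⟨t, s', he, ht, hs⟩ := h
  exact ⟨t, s', he, ht.trans hB, hQ _ hs⟩

theorem Runs.seq {W : ℕ} {c d : Prog} {s : State} {B B' : ℕ} {Q Q' : State → Prop}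
    (h : Runs W c s B Q) (h' : ∀ s', Q s' → Runs W d s' B' Q') :
    Runs W (.seq c d) s (B + B') Q' := by
  obtain ⟨t, s', he, ht, hs⟩ := h
  obtain ⟨t', s'', he', ht', hs'⟩ := h' s' hs
  exact ⟨_, _, Exec.seq _ _ _ _ _ _ _ he he', by omega, hs'⟩

theorem Runs.assign {W : ℕ} {s : State} {x : ℕ} {e : Expr} {Q : State → Prop}
    (he : e.Fits W s) (hQ : Q { s with var := Function.update s.var x (e.value s) }) :
    Runs W (.assign x e) s (e.cost + 1) Q :=
  ⟨_, _, Exec.assign s x e he, le_rfl, hQ⟩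

/-- A counting loop, by an invariant `I i` for the memory before the round `i`. -/
theorem Runs.count {W N B j : ℕ} {c : Prog} {I : ℕ → State → Prop}
    (hN : N ≤ W) (hW : 1 ≤ W)
    (hI : ∀ i s, I i s → i ≤ N → s.var j = i ∧ s.var 0 = N)
    (hc : ∀ i s, i < N → I i s → Runs W c s B (I (i + 1))) :
    ∀ (m i : ℕ) (s : State), i + m = N → I i s →
      Runs W (.loop (.op .lt (.var j) (.var 0)) c) s (m * (B + 4) + 4) (I N) := by
  intro m
  induction m with
  | zero =>
    intro i s hi h
    obtain ⟨h1, h2⟩ := hI i s h (by omega)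
    refine ⟨_, s, Exec.loop_false _ _ _ ?_ ?_, ?_, ?_⟩
    · simp only [Expr.Fits, Expr.value, Op.apply, h1, h2]; split <;> omega
    · simp [Expr.value, Op.apply, h1, h2]; omega
    · simp [Expr.cost]
    · obtain rfl : i = N := by omega
      exact h
  | succ m ih =>
    intro i s hi h
    obtain ⟨h1, h2⟩ := hI i s h (by omega)
    obtain ⟨t, s', he, ht, hs⟩ := hc i s (by omega) h
    obtain ⟨t', s'', he', ht', hs'⟩ := ih (i + 1) s' (by omega) hs
    refine ⟨_, s'', Exec.loop_true _ _ _ _ _ _ _ ?_ ?_ he he', ?_, hs'⟩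
    · simp [Expr.Fits, Expr.value, Op.apply, h1, h2]
      split <;> omega
    · simp [Expr.value, Op.apply, h1, h2]; omega
    · simp only [Expr.cost]
      rw [Nat.add_mul]
      omega

theorem Op.apply_le_pow {X : ℕ} (hX : 2 ≤ X) (o : Op) {x y a b : ℕ} (ha : 1 ≤ a) (hb : 1 ≤ b)
    (hx : x ≤ X ^ a) (hy : y ≤ X ^ b) : o.apply x y ≤ X ^ (a + b) := by
  have h1 : X ≤ X ^ a := Nat.le_self_pow (by omega) X
  have h2 : X ≤ X ^ b := Nat.le_self_pow (by omega) X
  have h3 : X ^ (a + b) = X ^ a * X ^ b := pow_add _ _ _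
  have h4 : X ^ a + X ^ b ≤ X ^ a * X ^ b := by nlinarith
  cases o <;> simp only [Op.apply]
  · omega
  · omega
  · rw [h3]; exact Nat.mul_le_mul hx hy
  · split <;> omega
  · split <;> omega

theorem Term.one_le_deg (e : Term) : 1 ≤ e.deg := by
  induction e <;> simp only [Term.deg] <;> omega

theorem Agg.step_le (g : Agg) {x y a b : ℕ} (hx : x ≤ a) (hy : y ≤ b) : g.step x y ≤ a + b := by
  cases g <;> simp only [Agg.step] <;> omega

theorem agg_rec_le {B : ℕ} (g : Agg) (f : ℕ → ℕ) (N : ℕ) (hf : ∀ i < N, f i ≤ B) :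
    ∀ m ≤ N, (Nat.rec 0 (fun i acc => g.step acc (f i)) m : ℕ) ≤ m * B := by
  intro m
  induction m with
  | zero => intro _; simp
  | succ m ih =>
    intro hm
    rw [Nat.add_mul, one_mul]
    exact g.step_le (ih (by omega)) (hf m (by omega))

/-- All values are polynomially bounded. -/
theorem Term.val_le {N X : ℕ} {A : ℕ → ℕ → ℕ} (hX : 2 ≤ X) (hN : N ≤ X) (hA : ∀ a i, A a i ≤ X)
    (e : Term) : ∀ env : ℕ → ℕ, (∀ x, env x ≤ X) → e.maxConst ≤ X →
      e.val N A env ≤ X ^ e.deg := by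
  induction e with
  | const k => intro env _ h; simpa [Term.val, Term.deg, Term.maxConst] using h
  | var x => intro env h _; simpa [Term.val, Term.deg] using h x
  | get a i ih =>
    intro env _ _
    exact (hA _ _).trans (Nat.le_self_pow (by have := i.one_le_deg; simp only [Term.deg]; omega) X)
  | op o e f ihe ihf =>
    intro env h hc
    simp only [Term.maxConst] at hc
    exact Op.apply_le_pow hX o e.one_le_deg f.one_le_deg (ihe env h (by omega))
      (ihf env h (by omega))
  | agg g x e ih =>
    intro env h hc
    simp only [Term.val, Term.deg]
    refine (agg_rec_le (B := X ^ e.deg) g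
      (fun i => e.val N A (Function.update env x i)) N ?_ N le_rfl).trans ?_
    · intro i hi
      refine ih _ (fun y => ?_) hc
      by_cases hy : y = x
      · subst hy; simp; omega
      · simp [hy, h y]
    · rw [pow_succ, mul_comm]; exact Nat.mul_le_mul le_rfl hN

theorem Agg.value_expr (g : Agg) (k : ℕ) (s : State) :
    (g.expr k).value s = g.step (s.var k) (s.var (k + 2)) := by
  cases g <;> rfl

theorem Agg.fits_expr {W : ℕ} (g : Agg) (k : ℕ) (s : State) (h1 : s.var k ≤ W)
    (h2 : s.var (k + 2) ≤ W) (h3 : g.step (s.var k) (s.var (k + 2)) ≤ W) :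
    (g.expr k).Fits W s := by
  cases g
  · exact ⟨h1, h2, h3⟩
  · refine ⟨h1, ⟨h2, h1, ?_⟩, h3⟩
    simp only [Expr.value, Op.apply]; omega

theorem Agg.cost_expr_le (g : Agg) (k : ℕ) : (g.expr k).cost ≤ 5 := by
  cases g <;> simp [Agg.expr, Expr.cost]

theorem update_comp_register {v : ℕ → ℕ} {ρ : ℕ → ℕ} {x j i : ℕ} {v' : ℕ → ℕ} {k : ℕ}
    (hρ : ∀ y, ρ y < k) (hv : ∀ y < k, v' y = v y) (hj : v' j = i) :
    v' ∘ Function.update ρ x j = Function.update (v ∘ ρ) x i := by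
  funext y
  by_cases hy : y = x
  · subst hy; simp [hj]
  · simp [hy, hv _ (hρ y)]

/-- Compiled terms compute the value of the term in time `O(N ^ height)`. -/
theorem Term.runs_compile {N X W : ℕ} {A : ℕ → ℕ → ℕ} (hX : 2 ≤ X) (hN : N ≤ X) (hN1 : 1 ≤ N)
    (hA : ∀ a i, A a i ≤ X) (e : Term) :
    ∀ (ρ : ℕ → ℕ) (k : ℕ) (s : State), (∀ x, ρ x < k) → s.var 0 = N → s.arr = A →
      (∀ x, s.var (ρ x) ≤ X) → e.maxConst ≤ X → X ^ e.deg ≤ W →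
      Runs W (e.compile ρ k) s (e.size * N ^ e.height) (fun s' =>
        s'.arr = A ∧ (∀ j < k, s'.var j = s.var j) ∧ s'.var k = e.val N A (s.var ∘ ρ)) := by
  induction e with
  | const c =>
    intro ρ k s hρ h0 hs hv hc hW
    simp only [Term.maxConst, Term.deg, pow_one] at hc hW
    refine (Runs.assign (Q := fun s' => s'.arr = A ∧ (∀ j < k, s'.var j = s.var j) ∧
      s'.var k = c) ?_ ⟨hs, ?_, ?_⟩).mono ?_ (fun _ h => h)
    · simp only [Expr.Fits]; omega
    · intro j hj; simp [Function.update_of_ne (show j ≠ k by omega)]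
    · simp [Expr.value]
    · simp [Expr.cost, Term.size, Term.height]
  | var x =>
    intro ρ k s hρ h0 hs hv hc hW
    simp only [Term.deg, pow_one] at hW
    refine (Runs.assign (Q := fun s' => s'.arr = A ∧ (∀ j < k, s'.var j = s.var j) ∧
      s'.var k = s.var (ρ x)) ?_ ⟨hs, ?_, ?_⟩).mono ?_ (fun _ h => h)
    · simp only [Expr.Fits]; exact (hv x).trans hW
    · intro j hj; simp [Function.update_of_ne (show j ≠ k by omega)]
    · simp [Expr.value]
    · simp [Expr.cost, Term.size, Term.height]
  | get a i ih =>
    intro ρ k s hρ h0 hs hv hc hW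
    simp only [Term.maxConst, Term.deg] at hc hW
    have hval : i.val N A (s.var ∘ ρ) ≤ X ^ i.deg := i.val_le hX hN hA _ hv hc
    have hXW : X ≤ W := (Nat.le_self_pow (by have := i.one_le_deg; omega) X).trans hW
    refine (Runs.seq (ih ρ k s hρ h0 hs hv hc hW) (fun s' h' => ?_) (B' := 3)
      (Q' := fun s' => s'.arr = A ∧ (∀ j < k, s'.var j = s.var j) ∧
        s'.var k = (Term.get a i).val N A (s.var ∘ ρ))).mono ?_ (fun _ h => h)
    · obtain ⟨h1, h2, h3⟩ := h'
      refine Runs.assign ?_ ⟨h1, ?_, ?_⟩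
      · simp only [Expr.Fits, Expr.value, h1, h3]
        exact ⟨hval.trans hW, (hA _ _).trans hXW⟩
      · intro j hj; simp [Function.update_of_ne (show j ≠ k by omega), h2 j hj]
      · simp [Expr.value, Term.val, h1, h3]
    · simp only [Term.size, Term.height, Nat.add_mul]
      have : 1 ≤ N ^ i.height := Nat.one_le_pow _ _ hN1
      omega
  | op o e f ihe ihf =>
    intro ρ k s hρ h0 hs hv hc hW
    simp only [Term.maxConst, Term.deg] at hc hW
    have he := e.one_le_deg
    have hf := f.one_le_deg
    have hWe : X ^ e.deg ≤ W := (Nat.pow_le_pow_right (by omega) (by omega)).trans hW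
    have hWf : X ^ f.deg ≤ W := (Nat.pow_le_pow_right (by omega) (by omega)).trans hW
    have hvale := e.val_le hX hN hA _ hv (by omega)
    have hvalf := f.val_le hX hN hA _ hv (by omega)
    refine (Runs.seq (ihe ρ k s hρ h0 hs hv (by omega) hWe) (fun s' h' => ?_)
      (B' := f.size * N ^ f.height + 4)
      (Q' := fun s' => s'.arr = A ∧ (∀ j < k, s'.var j = s.var j) ∧
        s'.var k = (Term.op o e f).val N A (s.var ∘ ρ))).mono ?_ (fun _ h => h)
    · obtain ⟨h1, h2, h3⟩ := h'
      have hk : 0 < k := lt_of_le_of_lt (Nat.zero_le _) (hρ 0)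
      have hcomp : s'.var ∘ ρ = s.var ∘ ρ := funext fun x => h2 _ (hρ x)
      refine Runs.seq (ihf ρ (k + 1) s' (fun x => (hρ x).trans (by omega)) ((h2 0 hk).trans h0) h1
        (fun x => by rw [h2 _ (hρ x)]; exact hv x) (by omega) hWf) (fun s'' h'' => ?_)
      obtain ⟨h4, h5, h6⟩ := h''
      have h7 : s''.var k = e.val N A (s.var ∘ ρ) := by rw [h5 k (by omega), h3]
      rw [hcomp] at h6
      refine Runs.assign ?_ ⟨h4, ?_, ?_⟩
      · simp only [Expr.Fits, Expr.value, h6, h7]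
        exact ⟨hvale.trans hWe, hvalf.trans hWf, (Op.apply_le_pow hX o he hf hvale hvalf).trans hW⟩
      · intro j hj
        simp [Function.update_of_ne (show j ≠ k by omega), h5 j (by omega), h2 j hj]
      · simp [Expr.value, Term.val, h6, h7]
    · simp only [Term.size, Term.height, Nat.add_mul]
      have h1 : N ^ e.height ≤ N ^ max e.height f.height :=
        Nat.pow_le_pow_right hN1 (le_max_left _ _)
      have h2 : N ^ f.height ≤ N ^ max e.height f.height :=
        Nat.pow_le_pow_right hN1 (le_max_right _ _)
      have h3 : 1 ≤ N ^ max e.height f.height := Nat.one_le_pow _ _ hN1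
      have h4 := Nat.mul_le_mul_left e.size h1
      have h5 := Nat.mul_le_mul_left f.size h2
      omega
  | agg g x e ih =>
    intro ρ k s hρ h0 hs hv hc hW
    simp only [Term.maxConst, Term.deg] at hc hW
    have hk : 0 < k := lt_of_le_of_lt (Nat.zero_le _) (hρ 0)
    have hXW : X ≤ W := (Nat.le_self_pow (by omega) X).trans hW
    have hWe : X ^ e.deg ≤ W := (Nat.pow_le_pow_right (by omega) (by omega)).trans hW
    have henv : ∀ i ≤ N, ∀ y, Function.update (s.var ∘ ρ) x i y ≤ X := by
      intro i hi y
      by_cases hy : y = x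
      · subst hy; simp; omega
      · simp [hy, hv y]
    set f : ℕ → ℕ := fun i => e.val N A (Function.update (s.var ∘ ρ) x i) with hf
    have hfle : ∀ i ≤ N, f i ≤ X ^ e.deg := fun i hi => e.val_le hX hN hA _ (henv i hi) hc
    set r : ℕ → ℕ := fun m => Nat.rec 0 (fun i acc => g.step acc (f i)) m with hr
    have hrle : ∀ m ≤ N, r m ≤ X ^ (e.deg + 1) := by
      intro m hm
      refine (agg_rec_le g f N (fun i hi => hfle i hi.le) m hm).trans ?_
      rw [pow_succ, mul_comm]; exact Nat.mul_le_mul le_rfl (hm.trans hN)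
    let I : ℕ → State → Prop := fun i s' => s'.arr = A ∧ (∀ j < k, s'.var j = s.var j) ∧
      s'.var k = r i ∧ s'.var (k + 1) = i
    have hloop := Runs.count (W := W) (N := N) (B := e.size * N ^ e.height + 10) (j := k + 1)
      (c := .seq (e.compile (Function.update ρ x (k + 1)) (k + 2))
            (.seq (.assign k (g.expr k))
              (.assign (k + 1) (.op .add (.var (k + 1)) (.const 1))))) (I := I)
      (by omega) (by omega) (fun i s' h _ => ⟨h.2.2.2, (h.2.1 0 hk).trans h0⟩) (by
        intro i s' hi h
        obtain ⟨h1, h2, h3, h4⟩ := h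
        have hcomp : s'.var ∘ Function.update ρ x (k + 1) = Function.update (s.var ∘ ρ) x i :=
          update_comp_register hρ h2 h4
        refine Runs.seq (ih (Function.update ρ x (k + 1)) (k + 2) s' ?_ ((h2 0 hk).trans h0) h1 ?_
          hc hWe) (fun s'' h'' => ?_)
        · intro y
          by_cases hy : y = x
          · subst hy; simp
          · simp only [Function.update_of_ne hy]; exact (hρ y).trans (by omega)
        · intro y
          have := congrFun hcomp y
          simp only [Function.comp] at this
          rw [this]; exact henv i hi.le y
        obtain ⟨h5, h6, h7⟩ := h''
        have h8 : s''.var k = r i := (h6 k (by omega)).trans h3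
        have h9 : s''.var (k + 2) = f i := by rw [h7, hcomp]
        have h10 : r (i + 1) = g.step (r i) (f i) := rfl
        have h11 := hrle (i + 1) hi
        refine (Runs.seq (Runs.assign (Q := fun s3 => s3.arr = A ∧ (∀ j < k, s3.var j = s.var j) ∧
          s3.var k = r (i + 1) ∧ s3.var (k + 1) = i) (g.fits_expr k s'' ?_ ?_ ?_) ⟨h5, ?_, ?_, ?_⟩)
          (fun s3 hs3 => Runs.assign ?_ ⟨hs3.1, ?_, ?_, ?_⟩)).mono ?_ (fun _ h => h)
        · rw [h8]; exact (hrle i hi.le).trans hW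
        · rw [h9]; exact (hfle i hi.le).trans hWe
        · rw [h8, h9, ← h10]; exact h11.trans hW
        · intro j hj
          simp only [Function.update_of_ne (show j ≠ k by omega)]
          rw [h6 j (by omega), h2 j hj]
        · simp [g.value_expr, h8, h9, h10]
        · simp only [Function.update_of_ne (show k + 1 ≠ k by omega)]
          rw [h6 _ (by omega), h4]
        · simp only [Expr.Fits, Expr.value, Op.apply, hs3.2.2.2]; omega
        · have := g.cost_expr_le k
          simp only [Expr.cost]; omega
        · intro j hj
          simp only [Function.update_of_ne (show j ≠ k + 1 by omega)]
          exact hs3.2.1 j hj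
        · simp only [Function.update_of_ne (show k ≠ k + 1 by omega)]; exact hs3.2.2.1
        · simp [Expr.value, Op.apply, hs3.2.2.2])
    refine (Runs.seq (Runs.assign (Q := fun s' => s'.arr = A ∧ (∀ j < k, s'.var j = s.var j) ∧
        s'.var k = 0) ?_ ⟨hs, ?_, ?_⟩) (fun s1 hs1 => Runs.seq (Runs.assign (Q := I 0) ?_ ?_)
          (fun s2 hs2 => hloop N 0 s2 (by omega) hs2))).mono ?_ ?_
    · simp [Expr.Fits]
    · intro j hj; simp [Function.update_of_ne (show j ≠ k by omega)]
    · simp [Expr.value]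
    · simp [Expr.Fits]
    · refine ⟨hs1.1, ?_, ?_, ?_⟩
      · intro j hj
        simp only [Function.update_of_ne (show j ≠ k + 1 by omega)]
        exact hs1.2.1 j hj
      · simp only [Function.update_of_ne (show k ≠ k + 1 by omega)]; exact hs1.2.2
      · simp [Expr.value]
    · simp only [Term.size, Term.height, Expr.cost, pow_succ]
      have h1 : 1 ≤ N ^ e.height := Nat.one_le_pow _ _ hN1
      nlinarith [Nat.mul_le_mul h1 hN1]
    · intro s' h
      exact ⟨h.1, h.2.1, h.2.2.1⟩

theorem Stmt.run_le {N X : ℕ} (hN : 8 * N ≤ X) (c : Stmt) :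
    ∀ (env : ℕ → ℕ) (A : ℕ → ℕ → ℕ), (∀ a i, A a i ≤ X) → ∀ a i, c.run N env A a i ≤ X := by
  induction c with
  | store a' i' e =>
    intro env A hA a i
    simp only [Stmt.run, Function.update_apply]
    split
    · rw [Function.update_apply]
      split
      · omega
      · exact hA _ _
    · exact hA _ _
  | seq c d ihc ihd => intro env A hA; exact ihd env _ (ihc env A hA)
  | loop x c ih =>
    intro env A hA
    have : ∀ m', ∀ a i, (Nat.rec A (fun i A' => c.run N (Function.update env x i) A') m' :
        ℕ → ℕ → ℕ) a i ≤ X := by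
      intro m'
      induction m' with
      | zero => exact hA
      | succ m' ih' => exact ih _ _ ih'
    exact this N

/-- Compiled statements have the effect of the statement in time `O(N ^ height)`. -/
theorem Stmt.runs_compile {N X W : ℕ} (hX : 8 ≤ X) (hN : 8 * N ≤ X) (hN1 : 1 ≤ N) (c : Stmt) :
    ∀ (ρ : ℕ → ℕ) (k : ℕ) (s : State), (∀ x, ρ x < k) → s.var 0 = N → (∀ a i, s.arr a i ≤ X) →
      (∀ x, s.var (ρ x) ≤ X) → c.maxConst ≤ X → X ^ c.deg ≤ W → X ≤ W →
      Runs W (c.compile ρ k) s (c.size * N ^ c.height) (fun s' =>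
        s'.arr = c.run N (s.var ∘ ρ) s.arr ∧ (∀ j < k, s'.var j = s.var j)) := by
  induction c with
  | store a i e =>
    intro ρ k s hρ h0 hA hv hc hW hXW
    simp only [Stmt.maxConst, Stmt.deg] at hc hW
    have hk : 0 < k := lt_of_le_of_lt (Nat.zero_le _) (hρ 0)
    have hWi : X ^ i.deg ≤ W := (Nat.pow_le_pow_right (by omega) (le_max_left _ _)).trans hW
    have hWe : X ^ e.deg ≤ W := (Nat.pow_le_pow_right (by omega) (le_max_right _ _)).trans hW
    have hvali := i.val_le (N := N) (by omega) (by omega) hA (s.var ∘ ρ) hv (by omega)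
    have hvale := e.val_le (N := N) (by omega) (by omega) hA (s.var ∘ ρ) hv (by omega)
    refine (Runs.seq (i.runs_compile (by omega) (by omega) hN1 hA ρ k s hρ h0 rfl hv (by omega) hWi)
      (fun s' h' => ?_) (B' := e.size * N ^ e.height + 9)
      (Q' := fun s' => s'.arr = (Stmt.store a i e).run N (s.var ∘ ρ) s.arr ∧
        (∀ j < k, s'.var j = s.var j))).mono ?_ (fun _ h => h)
    · obtain ⟨h1, h2, h3⟩ := h'
      have hcomp : s'.var ∘ ρ = s.var ∘ ρ := funext fun x => h2 _ (hρ x)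
      refine Runs.seq (e.runs_compile (by omega) (by omega) hN1 hA ρ (k + 1) s'
        (fun x => (hρ x).trans (by omega)) ((h2 0 hk).trans h0) h1
        (fun x => by rw [h2 _ (hρ x)]; exact hv x) (by omega) hWe) (fun s'' h'' => ?_)
      obtain ⟨h4, h5, h6⟩ := h''
      have h7 : s''.var k = i.val N s.arr (s.var ∘ ρ) := by rw [h5 k (by omega), h3]
      have h8 : s''.var 0 = N := by rw [h5 0 (by omega), h2 0 hk, h0]
      rw [hcomp] at h6
      refine ⟨_, _, Exec.store _ _ _ _ ?_ ?_, ?_, ?_, ?_⟩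
      · simp only [Expr.Fits, h7]; exact hvali.trans hWi
      · simp only [Expr.Fits, Expr.value, Op.apply, h6, h8]
        have := hvale.trans hWe
        omega
      · simp [Expr.cost]
      · simp only [Stmt.run, Expr.value, Op.apply, h6, h7, h8, h4]
        congr 2
        omega
      · intro j hj
        rw [h5 j (by omega), h2 j hj]
    · simp only [Stmt.size, Stmt.height, Nat.add_mul]
      have h1 : N ^ i.height ≤ N ^ max i.height e.height :=
        Nat.pow_le_pow_right hN1 (le_max_left _ _)
      have h2 : N ^ e.height ≤ N ^ max i.height e.height :=
        Nat.pow_le_pow_right hN1 (le_max_right _ _)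
      have h3 : 1 ≤ N ^ max i.height e.height := Nat.one_le_pow _ _ hN1
      have h4 := Nat.mul_le_mul_left i.size h1
      have h5 := Nat.mul_le_mul_left e.size h2
      omega
  | seq c d ihc ihd =>
    intro ρ k s hρ h0 hA hv hc hW hXW
    simp only [Stmt.maxConst, Stmt.deg] at hc hW
    have hk : 0 < k := lt_of_le_of_lt (Nat.zero_le _) (hρ 0)
    have hWi : X ^ c.deg ≤ W := (Nat.pow_le_pow_right (by omega) (le_max_left _ _)).trans hW
    have hWe : X ^ d.deg ≤ W := (Nat.pow_le_pow_right (by omega) (le_max_right _ _)).trans hW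
    refine (Runs.seq (ihc ρ k s hρ h0 hA hv (by omega) hWi hXW)
      (fun s' h' => (ihd ρ k s' hρ ?_ ?_ ?_ (by omega) hWe hXW).mono le_rfl ?_)
      (Q' := fun s' => s'.arr = (Stmt.seq c d).run N (s.var ∘ ρ) s.arr ∧
        (∀ j < k, s'.var j = s.var j))).mono ?_ (fun _ h => h)
    · rw [h'.2 0 hk, h0]
    · rw [h'.1]; exact c.run_le hN _ _ hA
    · intro x; rw [h'.2 _ (hρ x)]; exact hv x
    · intro s'' h''
      have hcomp : s'.var ∘ ρ = s.var ∘ ρ := funext fun x => h'.2 _ (hρ x)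
      rw [hcomp, h'.1] at h''
      exact ⟨h''.1, fun j hj => (h''.2 j hj).trans (h'.2 j hj)⟩
    · simp only [Stmt.size, Stmt.height, Nat.add_mul]
      exact Nat.add_le_add
        (Nat.mul_le_mul_left _ (Nat.pow_le_pow_right hN1 (le_max_left _ _)))
        (Nat.mul_le_mul_left _ (Nat.pow_le_pow_right hN1 (le_max_right _ _)))
  | loop x c ih =>
    intro ρ k s hρ h0 hA hv hc hW hXW
    simp only [Stmt.maxConst, Stmt.deg] at hc hW
    have hk : 0 < k := lt_of_le_of_lt (Nat.zero_le _) (hρ 0)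
    set r : ℕ → ℕ → ℕ → ℕ :=
      fun m => Nat.rec s.arr (fun i A' => c.run N (Function.update (s.var ∘ ρ) x i) A') m with hr
    have hrle : ∀ m a i, r m a i ≤ X := by
      intro m
      induction m with
      | zero => exact hA
      | succ m ih' => exact c.run_le hN _ _ ih'
    let I : ℕ → State → Prop := fun i s' => s'.arr = r i ∧ (∀ j < k, s'.var j = s.var j) ∧
      s'.var k = i
    have hloop := Runs.count (W := W) (N := N) (B := c.size * N ^ c.height + 4) (j := k)
      (c := .seq (c.compile (Function.update ρ x k) (k + 1))
              (.assign k (.op .add (.var k) (.const 1)))) (I := I)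
      (by omega) (by omega) (fun i s' h _ => ⟨h.2.2, (h.2.1 0 hk).trans h0⟩) (by
        intro i s' hi h
        obtain ⟨h1, h2, h3⟩ := h
        have hcomp : s'.var ∘ Function.update ρ x k = Function.update (s.var ∘ ρ) x i :=
          update_comp_register hρ h2 h3
        refine Runs.seq (ih (Function.update ρ x k) (k + 1) s' ?_ ((h2 0 hk).trans h0)
          (by rw [h1]; exact hrle i) ?_ hc hW hXW) (fun s'' h'' => ?_)
        · intro y
          by_cases hy : y = x
          · subst hy; simp
          · simp only [Function.update_of_ne hy]; exact (hρ y).trans (by omega)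
        · intro y
          have := congrFun hcomp y
          simp only [Function.comp] at this
          rw [this]
          by_cases hy : y = x
          · subst hy; simp; omega
          · simp [hy, hv y]
        obtain ⟨h5, h6⟩ := h''
        refine Runs.assign ?_ ⟨?_, ?_, ?_⟩
        · simp only [Expr.Fits, Expr.value, Op.apply, h6 k (by omega), h3]; omega
        · simp only [h5, hcomp, h1]; rfl
        · intro j hj
          simp only [Function.update_of_ne (show j ≠ k by omega)]
          rw [h6 j (by omega), h2 j hj]
        · simp [Expr.value, Op.apply, h6 k (by omega), h3])
    refine (Runs.seq (Runs.assign (Q := I 0) ?_ ⟨rfl, ?_, ?_⟩)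
      (fun s2 hs2 => hloop N 0 s2 (by omega) hs2)).mono ?_ ?_
    · simp [Expr.Fits]
    · intro j hj; simp [Function.update_of_ne (show j ≠ k by omega)]
    · simp [Expr.value]
    · simp only [Stmt.size, Stmt.height, Expr.cost, pow_succ]
      have h1 : 1 ≤ N ^ c.height := Nat.one_le_pow _ _ hN1
      nlinarith [Nat.mul_le_mul h1 hN1]
    · intro s' h
      exact ⟨h.1, h.2.1⟩

end LoopLang

namespace SimpleGraph

variable {V : Type*} {T : SimpleGraph V}

/-! ### Distances in trees -/

theorem IsTree.length_eq_dist (hT : T.IsTree) {x y : V} {p : T.Walk x y} (hp : p.IsPath) :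
    p.length = T.dist x y := by
  obtain ⟨q, hq, hq'⟩ := hT.connected.exists_path_of_dist x y
  rw [← hq', (hT.existsUnique_path x y).unique hp hq]

theorem IsTree.dist_add_dist_of_mem_support (hT : T.IsTree) {x y w : V} {p : T.Walk x y}
    (hp : p.IsPath) (hw : w ∈ p.support) : T.dist x w + T.dist w y = T.dist x y := by
  classical
  rw [← hT.length_eq_dist (hp.takeUntil hw), ← hT.length_eq_dist (hp.dropUntil hw),
    ← hT.length_eq_dist hp, ← Walk.length_append, p.take_spec]

theorem exists_adj_dist_eq (hT : T.Connected) {x w : V} {k : ℕ} (h : T.dist x w = k + 1) :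
    ∃ z, T.Adj w z ∧ T.dist x z = k := by
  obtain ⟨p, hp⟩ := hT.exists_walk_length_eq_dist w x
  rw [dist_comm, h] at hp
  cases p with
  | nil => simp at hp
  | cons hadj q =>
    rename_i z
    refine ⟨z, hadj, ?_⟩
    simp only [Walk.length_cons, add_left_inj] at hp
    have h1 := dist_le q
    have h2 := hT.dist_triangle (u := x) (v := z) (w := w)
    have h3 := dist_eq_one_iff_adj.mpr hadj.symm
    rw [dist_comm] at h1
    omega

/-- In a tree, a vertex has at most one neighbour that is closer to `x`. -/
theorem IsTree.eq_of_adj_of_dist_eq (hT : T.IsTree) {x w u v : V} (hu : T.Adj w u)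
    (hv : T.Adj w v) (hu' : T.dist x w = T.dist x u + 1) (hv' : T.dist x w = T.dist x v + 1) :
    u = v := by
  classical
  have key : ∀ u, T.Adj w u → T.dist x w = T.dist x u + 1 →
      ∃ q : T.Walk x u, ∃ h : T.Adj u w, (q.concat h).IsPath := by
    intro u hu hd
    obtain ⟨q, hq⟩ := hT.connected.exists_walk_length_eq_dist x u
    exact ⟨q, hu.symm, Walk.isPath_of_length_eq_dist _ (by rw [Walk.length_concat, hq, hd])⟩
  obtain ⟨q, hq, hqp⟩ := key u hu hu'
  obtain ⟨r, hr, hrp⟩ := key v hv hv'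
  have := congrArg Walk.penultimate ((hT.existsUnique_path x w).unique hqp hrp)
  simpa using this

/-- An edge that leads away from `x` and towards `y` lies on the path between `x` and `y`. -/
theorem IsTree.dist_eq_of_edge_between (hT : T.IsTree) {x y : V} :
    ∀ (k : ℕ) {u w : V}, T.dist y w = k → T.Adj u w → T.dist x w = T.dist x u + 1 →
      T.dist y u = T.dist y w + 1 → T.dist x y = T.dist x w + T.dist y w := by
  intro k
  induction k with
  | zero =>
    intro u w hk _ _ _
    obtain rfl := hT.connected.dist_eq_zero_iff.mp hk
    simp
  | succ k ih =>
    intro u w hk hadj hx hy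
    obtain ⟨z, hz, hzk⟩ := exists_adj_dist_eq hT.connected hk
    have hne : z ≠ u := by rintro rfl; omega
    rcases hT.dist_eq_dist_add_one_of_adj x hz with h | h
    · exact absurd (hT.eq_of_adj_of_dist_eq hz hadj.symm h hx) hne
    · have := ih hzk hz h (by omega)
      omega

/-! ### Caterpillars as paths with hairs -/

/-- A description of a graph as a backbone with hairs: the backbone vertices have height `0` and
positions `0, …, len`; a vertex of positive height lies on a hair, `pos` is the position
of the backbone vertex where the hair is attached, and `down` leads one step towards the
backbone. -/
structure HairedPath (T : SimpleGraph V) where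
  len : ℕ
  pos : V → ℕ
  height : V → ℕ
  down : V → V
  pos_le : ∀ w, pos w ≤ len
  adj_cases : ∀ {u w}, T.Adj u w →
    (height u = 0 ∧ height w = 0 ∧ (pos w = pos u + 1 ∨ pos u = pos w + 1)) ∨
    (pos u = pos w ∧ (height w = height u + 1 ∨ height u = height w + 1))
  adj_down : ∀ {w}, height w ≠ 0 → T.Adj w (down w) ∧ height w = height (down w) + 1
  down_eq : ∀ {u w}, T.Adj w u → height w = height u + 1 → down w = u
  eq_of_down_eq : ∀ {u v}, height u ≠ 0 → height v ≠ 0 → height (down u) ≠ 0 →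
    down u = down v → u = v
  exists_backbone : ∀ p ≤ len, ∃ w, height w = 0 ∧ pos w = p
  backbone_unique : ∀ {u v}, height u = 0 → height v = 0 → pos u = pos v → u = v
  backbone_adj : ∀ {u v}, height u = 0 → height v = 0 → pos v = pos u + 1 → T.Adj u v

section Backbone

variable (T) (x y : V)

/-- The position of the projection of `w` to the path from `x` to `y` in a tree. -/
noncomputable def projPos (w : V) : ℕ := (T.dist x w + T.dist x y - T.dist y w) / 2

/-- The distance of `w` to the path from `x` to `y` in a tree. -/
noncomputable def projHeight (w : V) : ℕ := (T.dist x w + T.dist y w - T.dist x y) / 2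

variable {T}

theorem IsTree.even_dist_add_dist (hT : T.IsTree) (w : V) :
    Even (T.dist x w + T.dist y w + T.dist x y) := by
  obtain ⟨p⟩ := hT.connected x w
  induction p using Walk.concatRec with
  | Hnil => rename_i u; rw [dist_self, dist_comm]; exact ⟨T.dist u y, by omega⟩
  | Hconcat p h ih =>
    rename_i u v w
    rw [Nat.even_iff] at ih ⊢
    have h1 := hT.dist_eq_dist_add_one_of_adj u h
    have h2 := hT.dist_eq_dist_add_one_of_adj y h
    omega

theorem IsTree.dist_eq_proj (hT : T.IsTree) (w : V) :
    T.dist x w = T.projPos x y w + T.projHeight x y w ∧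
    T.dist y w + T.projPos x y w = T.dist x y + T.projHeight x y w ∧
    T.projPos x y w ≤ T.dist x y := by
  have h1 := hT.even_dist_add_dist x y w
  rw [Nat.even_iff] at h1
  have h2 := hT.connected.dist_triangle (u := x) (v := w) (w := y)
  have h3 := hT.connected.dist_triangle (u := x) (v := y) (w := w)
  have h4 := hT.connected.dist_triangle (u := y) (v := x) (w := w)
  rw [dist_comm (u := w)] at h2
  rw [dist_comm (u := y) (v := x)] at h4
  unfold projPos projHeight
  omega

theorem IsTree.proj_adj_cases (hT : T.IsTree) {u w : V} (h : T.Adj u w) :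
    (T.projHeight x y u = 0 ∧ T.projHeight x y w = 0 ∧
      (T.projPos x y w = T.projPos x y u + 1 ∨ T.projPos x y u = T.projPos x y w + 1)) ∨
    (T.projPos x y u = T.projPos x y w ∧
      (T.projHeight x y w = T.projHeight x y u + 1 ∨
        T.projHeight x y u = T.projHeight x y w + 1)) := by
  have h1 := hT.dist_eq_proj x y u
  have h2 := hT.dist_eq_proj x y w
  rcases hT.dist_eq_dist_add_one_of_adj x h with hx | hx <;>
    rcases hT.dist_eq_dist_add_one_of_adj y h with hy | hy
  · omega
  · have := hT.dist_eq_of_edge_between _ rfl h.symm hx hy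
    omega
  · have := hT.dist_eq_of_edge_between _ rfl h hx hy
    omega
  · omega

theorem IsTree.exists_down (hT : T.IsTree) (w : V) : ∃ z, T.projHeight x y w ≠ 0 →
    T.Adj w z ∧ T.projHeight x y w = T.projHeight x y z + 1 := by
  by_cases h : T.projHeight x y w = 0
  · exact ⟨w, fun h' => absurd h h'⟩
  · have h1 := hT.dist_eq_proj x y w
    obtain ⟨z, hz, hz'⟩ := exists_adj_dist_eq hT.connected
      (show T.dist x w = (T.dist x w - 1) + 1 by omega)
    refine ⟨z, fun _ => ⟨hz, ?_⟩⟩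
    have h2 := hT.dist_eq_proj x y z
    rcases hT.proj_adj_cases x y hz with h3 | h3 <;> omega

theorem IsTree.exists_backbone (hT : T.IsTree) : ∀ p ≤ T.dist x y,
    ∃ w, T.projHeight x y w = 0 ∧ T.projPos x y w = p := by
  intro p
  induction p with
  | zero =>
    intro _
    have := hT.dist_eq_proj x y x
    rw [dist_self] at this
    exact ⟨x, by omega, by omega⟩
  | succ p ih =>
    intro hp
    obtain ⟨w, hw, hw'⟩ := ih (by omega)
    have h1 := hT.dist_eq_proj x y w
    obtain ⟨z, hz, hz'⟩ := exists_adj_dist_eq hT.connected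
      (show T.dist y w = (T.dist y w - 1) + 1 by omega)
    have h2 := hT.dist_eq_proj x y z
    refine ⟨z, ?_⟩
    rcases hT.proj_adj_cases x y hz with h3 | h3 <;> omega

theorem IsTree.backbone_unique (hT : T.IsTree) : ∀ (p : ℕ) {u v : V},
    T.projHeight x y u = 0 → T.projHeight x y v = 0 → T.projPos x y u = p →
      T.projPos x y v = p → u = v := by
  intro p
  induction p with
  | zero =>
    intro u v hu hv hu' hv'
    have h1 := hT.dist_eq_proj x y u
    have h2 := hT.dist_eq_proj x y v
    rw [← hT.connected.dist_eq_zero_iff.mp (show T.dist x u = 0 by omega),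
      ← hT.connected.dist_eq_zero_iff.mp (show T.dist x v = 0 by omega)]
  | succ p ih =>
    intro u v hu hv hu' hv'
    have h1 := hT.dist_eq_proj x y u
    have h2 := hT.dist_eq_proj x y v
    obtain ⟨z, hz, hz'⟩ := exists_adj_dist_eq hT.connected (show T.dist x u = p + 1 by omega)
    obtain ⟨z', hzv, hzv'⟩ := exists_adj_dist_eq hT.connected (show T.dist x v = p + 1 by omega)
    have h3 := hT.dist_eq_proj x y z
    have h4 := hT.dist_eq_proj x y z'
    have h5 := hT.proj_adj_cases x y hz
    have h6 := hT.proj_adj_cases x y hzv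
    obtain rfl : z = z' := ih (by omega) (by omega) (by omega) (by omega)
    exact hT.eq_of_adj_of_dist_eq (x := y) hz.symm hzv.symm (by omega) (by omega)

/-- If the path from `x` to `y` in a tree contains all vertices of degree at least three, then the
tree is this path with hairs. -/
noncomputable def IsTree.hairedPath (hT : T.IsTree) [T.LocallyFinite]
    (hdeg : ∀ w, 3 ≤ T.degree w → T.dist x w + T.dist w y = T.dist x y) : T.HairedPath where
  len := T.dist x y
  pos := T.projPos x y
  height := T.projHeight x y
  down w := (hT.exists_down x y w).choose
  pos_le w := (hT.dist_eq_proj x y w).2.2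
  adj_cases h := hT.proj_adj_cases x y h
  adj_down {w} h := (hT.exists_down x y w).choose_spec h
  down_eq {u w} h h' := by
    obtain ⟨h1, h2⟩ := (hT.exists_down x y w).choose_spec (by omega)
    have h3 := hT.proj_adj_cases x y h
    have h4 := hT.proj_adj_cases x y h1
    have h5 := hT.dist_eq_proj x y w
    have h6 := hT.dist_eq_proj x y u
    have h7 := hT.dist_eq_proj x y (hT.exists_down x y w).choose
    exact hT.eq_of_adj_of_dist_eq (x := x) h1 h (by omega) (by omega)
  eq_of_down_eq {u v} hu hv hd huv := by
    classical
    obtain ⟨h1, h2⟩ := (hT.exists_down x y u).choose_spec hu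
    obtain ⟨h3, h4⟩ := (hT.exists_down x y v).choose_spec hv
    rw [← huv] at h3 h4
    set w := (hT.exists_down x y u).choose
    obtain ⟨h5, h6⟩ := (hT.exists_down x y w).choose_spec hd
    set z := (hT.exists_down x y w).choose
    by_contra hne
    have hsub : ({u, v, z} : Finset V) ⊆ T.neighborFinset w := by
      intro a ha
      simp only [Finset.mem_insert, Finset.mem_singleton] at ha
      rw [mem_neighborFinset]
      rcases ha with rfl | rfl | rfl
      · exact h1.symm
      · exact h3.symm
      · exact h5
    have huz : u ≠ z := by rintro h; rw [h] at h2; omega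
    have hvz : v ≠ z := by rintro h; rw [h] at h4; omega
    have hcard : ({u, v, z} : Finset V).card = 3 := by
      rw [Finset.card_eq_three]; exact ⟨u, v, z, hne, huz, hvz, rfl⟩
    have h7 := hdeg w (by rw [← card_neighborFinset_eq_degree, ← hcard]; exact Finset.card_le_card hsub)
    have h8 := hT.dist_eq_proj x y w
    rw [dist_comm (u := w)] at h7
    omega
  exists_backbone := hT.exists_backbone x y
  backbone_unique hu hv h := hT.backbone_unique x y _ hu hv h rfl
  backbone_adj {u v} hu hv h := by
    have h1 := hT.dist_eq_proj x y u
    have h2 := hT.dist_eq_proj x y v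
    obtain ⟨z, hz, hz'⟩ := exists_adj_dist_eq hT.connected
      (show T.dist y u = (T.dist y u - 1) + 1 by omega)
    have h3 := hT.dist_eq_proj x y z
    have h4 := hT.proj_adj_cases x y hz
    rwa [hT.backbone_unique x y _ hv (show T.projHeight x y z = 0 by omega) h (by omega)]

/-- Two vertices at maximal distance among the vertices of a path span all of them. -/
theorem IsTree.dist_add_dist_of_farthest (hT : T.IsTree) {u v : V} {B : T.Walk u v}
    (hB : B.IsPath) {x y w : V} (hx : x ∈ B.support) (hy : y ∈ B.support) (hw : w ∈ B.support)
    (hxw : T.dist x w ≤ T.dist x y) (hyw : T.dist w y ≤ T.dist x y) :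
    T.dist x w + T.dist w y = T.dist x y := by
  classical
  have key : ∀ {a c : V}, a ∈ B.support → c ∈ B.support →
      T.dist u a = T.dist u c + T.dist a c ∨ T.dist u c = T.dist u a + T.dist a c := by
    intro a c ha hc
    have h1 := hT.dist_add_dist_of_mem_support hB ha
    have h2 := hT.dist_add_dist_of_mem_support hB hc
    have hc' := hc
    rw [← B.take_spec ha, Walk.mem_support_append_iff] at hc'
    rcases hc' with h | h
    · have := hT.dist_add_dist_of_mem_support (hB.takeUntil ha) h
      rw [dist_comm (u := a) (v := c)]
      omega
    · have := hT.dist_add_dist_of_mem_support (hB.dropUntil ha) h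
      omega
  have h1 := key hx hy
  have h2 := key hx hw
  have h3 := key hw hy
  omega

end Backbone

namespace HairedPath

variable (H : T.HairedPath)

theorem height_iterate_down (w : V) : ∀ m ≤ H.height w,
    H.height (H.down^[m] w) + m = H.height w ∧ H.pos (H.down^[m] w) = H.pos w := by
  intro m
  induction m with
  | zero => simp
  | succ m ih =>
    intro hm
    obtain ⟨h1, h2⟩ := ih (by omega)
    rw [Function.iterate_succ_apply']
    obtain ⟨h3, h4⟩ := H.adj_down (w := H.down^[m] w) (by omega)
    have h5 := H.adj_cases h3
    omega

theorem height_le_height_add_dist (hT : T.Connected) (u w : V) :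
    H.height w ≤ H.height u + T.dist u w := by
  obtain ⟨p, hp⟩ := hT.exists_walk_length_eq_dist u w
  rw [← hp]
  clear hp
  induction p with
  | nil => simp
  | cons h p ih =>
    have := H.adj_cases h
    rw [Walk.length_cons]
    omega

theorem dist_iterate_down_le (hT : T.Connected) (w : V) : ∀ m ≤ H.height w,
    T.dist (H.down^[m] w) w ≤ m := by
  intro m
  induction m with
  | zero => simp
  | succ m ih =>
    intro hm
    have h1 := ih (by omega)
    have h2 := H.height_iterate_down w m (by omega)
    rw [Function.iterate_succ_apply']
    have h3 := (H.adj_down (w := H.down^[m] w) (by omega)).1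
    have h4 := hT.dist_triangle (u := H.down (H.down^[m] w)) (v := H.down^[m] w) (w := w)
    rw [dist_eq_one_iff_adj.mpr h3.symm] at h4
    omega

/-- The vertices above `w` on its hair are those whose distance to `w` is the difference of the
heights. -/
theorem dist_add_height_iff (hT : T.Connected) {w v : V} :
    T.dist w v + H.height w = H.height v ↔
      H.height w ≤ H.height v ∧ H.down^[H.height v - H.height w] v = w := by
  constructor
  · intro h
    refine ⟨by omega, ?_⟩
    generalize hm : H.height v - H.height w = m
    induction m generalizing v with
    | zero => exact (hT.dist_eq_zero_iff.mp (show T.dist w v = 0 by omega)).symm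
    | succ m ih =>
      obtain ⟨z, hz, hz'⟩ := exists_adj_dist_eq hT (show T.dist w v = m + 1 by omega)
      have h1 := H.height_le_height_add_dist hT w z
      have h2 := H.adj_cases hz
      have h3 : H.height v = H.height z + 1 := by omega
      rw [Function.iterate_succ_apply, H.down_eq hz h3]
      exact ih (by omega) (by omega)
  · rintro ⟨h, h'⟩
    have h1 := H.dist_iterate_down_le hT v (H.height v - H.height w) (by omega)
    have h2 := H.height_le_height_add_dist hT w v
    rw [h'] at h1
    omega

/-- The lowest vertex of the hair of `w`. -/
def root (w : V) : V := H.down^[H.height w - 1] w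

/-- The backbone vertex below `w`. -/
def foot (w : V) : V := H.down^[H.height w] w

theorem height_foot (w : V) : H.height (H.foot w) = 0 := by
  have := (H.height_iterate_down w _ le_rfl).1
  unfold foot
  omega

theorem pos_foot (w : V) : H.pos (H.foot w) = H.pos w :=
  (H.height_iterate_down w _ le_rfl).2

theorem pos_root (w : V) : H.pos (H.root w) = H.pos w :=
  (H.height_iterate_down w _ (by omega)).2

theorem root_iterate_down {w : V} {m : ℕ} (hm : m < H.height w) :
    H.root (H.down^[m] w) = H.root w := by
  have h := (H.height_iterate_down w m hm.le).1
  unfold root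
  rw [← Function.iterate_add_apply]
  congr 2
  omega

theorem root_down {w : V} (h : H.height (H.down w) ≠ 0) (hw : H.height w ≠ 0) :
    H.root (H.down w) = H.root w :=
  H.root_iterate_down (m := 1) (by have := (H.adj_down hw).2; omega)

theorem eq_of_root_eq : ∀ (t : ℕ) {u v : V}, H.height u = t + 1 → H.height v = t + 1 →
    H.root u = H.root v → u = v := by
  intro t
  induction t with
  | zero => intro u v hu hv h; simpa [root, hu, hv] using h
  | succ t ih =>
    intro u v hu hv h
    have h1 := (H.adj_down (w := u) (by omega)).2
    have h2 := (H.adj_down (w := v) (by omega)).2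
    refine H.eq_of_down_eq (by omega) (by omega) (by omega) (ih (by omega) (by omega) ?_)
    rw [H.root_down (by omega) (by omega), H.root_down (by omega) (by omega), h]

/-- Along an edge of a hair, the same vertices are above up to the lower end of the edge. -/
theorem above_iff (hT : T.Connected) {u w v : V} (h : T.Adj w u)
    (hh : H.height w = H.height u + 1) (hu : H.height u ≠ 0) (hvu : v ≠ u) :
    T.dist u v + H.height u = H.height v ↔ T.dist w v + H.height w = H.height v := by
  rw [H.dist_add_height_iff hT, H.dist_add_height_iff hT]
  have hd := H.down_eq h hh
  constructor
  · rintro ⟨h1, h2⟩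
    have h3 : H.height v ≠ H.height u := by
      intro h3
      rw [h3, Nat.sub_self] at h2
      exact hvu h2
    refine ⟨by omega, ?_⟩
    have h4 := H.height_iterate_down v (H.height v - H.height w) (by omega)
    refine H.eq_of_down_eq (by omega) (by omega) ?_ ?_ <;>
      rw [← Function.iterate_succ_apply' (f := H.down),
        show (H.height v - H.height w).succ = H.height v - H.height u by omega, h2]
    · exact hu
    · exact hd.symm
  · rintro ⟨h1, h2⟩
    refine ⟨by omega, ?_⟩
    rw [show H.height v - H.height u = (H.height v - H.height w) + 1 by omega,
      Function.iterate_succ_apply', h2, hd]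

end HairedPath

end SimpleGraph

namespace SimpleGraph

open Finset

variable {V : Type*} {T : SimpleGraph V}

/-! ### Orderings in which neighbours are close -/

/-- Neighbours are at distance at most `b` in the injective ordering `α`. -/
structure IsOrdering (T : SimpleGraph V) (b : ℕ) (α : V → ℤ) : Prop where
  injective : Function.Injective α
  le : ∀ {u v}, T.Adj u v → α v ≤ α u + b

namespace IsOrdering

variable {b : ℕ} {α : V → ℤ}

theorem le_add_length (hα : T.IsOrdering b α) {u v : V} (p : T.Walk u v) :
    α v ≤ α u + b * p.length := by
  induction p with
  | nil => simp
  | cons h p ih =>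
    have := hα.le h
    rw [Walk.length_cons]
    push_cast
    linarith

/-- A walk that passes the position `x` visits one of the `b` positions that end at `x`. -/
theorem exists_mem_window (hα : T.IsOrdering b α) (hb : 0 < b) {x : ℤ} {u v : V} (p : T.Walk u v)
    (hu : α u ≤ x) (hv : x ≤ α v) : ∃ z ∈ p.support, x - b < α z ∧ α z ≤ x := by
  induction p with
  | nil => exact ⟨_, Walk.start_mem_support _, by omega, hu⟩
  | cons h p ih =>
    rename_i u w v
    by_cases hw : α w ≤ x
    · obtain ⟨z, hz, hz'⟩ := ih hw hv
      exact ⟨z, by rw [Walk.support_cons]; exact List.mem_cons_of_mem _ hz, hz'⟩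
    · have := hα.le h
      exact ⟨u, Walk.start_mem_support _, by omega, hu⟩

theorem card_le (hα : T.IsOrdering b α) (hT : T.Connected) (Y : Finset V) (d : ℕ)
    (hY : ∀ u ∈ Y, ∀ v ∈ Y, T.dist u v ≤ d) : #Y ≤ b * d + 1 := by
  rcases Y.eq_empty_or_nonempty with rfl | hne
  · simp
  obtain ⟨u, hu, hmin⟩ := Y.exists_min_image α hne
  have h : #(Y.image α) ≤ #(Icc (α u) (α u + (b * d : ℕ))) := by
    refine card_le_card fun z hz => ?_
    obtain ⟨v, hv, rfl⟩ := mem_image.mp hz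
    obtain ⟨p, hp⟩ := hT.exists_walk_length_eq_dist u v
    have h1 := hα.le_add_length p
    have h2 : b * p.length ≤ b * d := Nat.mul_le_mul_left _ (hp ▸ hY u hu v hv)
    have h3 := hmin v hv
    rw [mem_Icc]
    push_cast
    refine ⟨h3, h1.trans ?_⟩
    have : ((b * p.length : ℕ) : ℤ) ≤ (b * d : ℕ) := by exact_mod_cast h2
    push_cast at this
    linarith
  rw [card_image_of_injective _ hα.injective, Int.card_Icc] at h
  omega

/-- The step that lengthens combs: let `f` be joined to `a` by `p` and to `c` by `q`, and let `S` be
a connected set around `f` with too many vertices for the gap between `a` and `c`. Then the window of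
`a` is hit by `q` or `S`, or the window of `c` is hit by `p` or `S`. -/
theorem exists_crossing (hα : T.IsOrdering b α) (hb : 0 < b) {f a c : V} (hac : α a < α c)
    (p : T.Walk f a) (q : T.Walk f c) (S : Finset V)
    (hS : ∀ z ∈ S, ∃ r : T.Walk f z, ∀ v ∈ r.support, v ∈ S) (hcard : α c ≤ α a + #S) :
    (∃ z, (z ∈ q.support ∨ z ∈ S) ∧ α a - b < α z ∧ α z ≤ α a) ∨
    (∃ z, (z ∈ p.support ∨ z ∈ S) ∧ α c - b < α z ∧ α z ≤ α c) := by
  by_cases h1 : α f ≤ α a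
  · obtain ⟨z, hz, hz'⟩ := hα.exists_mem_window hb q h1 hac.le
    exact .inl ⟨z, .inl hz, hz'⟩
  by_cases h2 : α c ≤ α f
  · obtain ⟨z, hz, hz'⟩ := hα.exists_mem_window hb p.reverse hac.le h2
    rw [Walk.support_reverse, List.mem_reverse] at hz
    exact .inr ⟨z, .inl hz, hz'⟩
  obtain ⟨z, hz, hz'⟩ : ∃ z ∈ S, α z ≤ α a ∨ α c ≤ α z := by
    by_contra! hcon
    have h : #(S.image α) ≤ #(Ioo (α a) (α c)) := by
      refine card_le_card fun z hz => ?_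
      obtain ⟨v, hv, rfl⟩ := mem_image.mp hz
      exact mem_Ioo.mpr (hcon v hv)
    rw [card_image_of_injective _ hα.injective, Int.card_Ioo] at h
    omega
  obtain ⟨r, hr⟩ := hS z hz
  rcases hz' with hz' | hz'
  · obtain ⟨v, hv, hv'⟩ := hα.exists_mem_window hb r.reverse hz' (by omega)
    rw [Walk.support_reverse, List.mem_reverse] at hv
    exact .inl ⟨v, .inr (hr v hv), hv'⟩
  · obtain ⟨v, hv, hv'⟩ := hα.exists_mem_window hb r (by omega) hz'
    exact .inr ⟨v, .inr (hr v hv), hv'⟩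

end IsOrdering

namespace HairedPath

variable (H : T.HairedPath)

theorem exists_backbone_walk : ∀ (d : ℕ) {u v : V}, H.height u = 0 → H.height v = 0 →
    H.pos v = H.pos u + d → ∃ p : T.Walk u v, p.length = d ∧
      ∀ z ∈ p.support, H.pos u ≤ H.pos z ∧ H.pos z ≤ H.pos v := by
  intro d
  induction d with
  | zero =>
    intro u v hu hv h
    obtain rfl := H.backbone_unique hu hv h.symm
    exact ⟨.nil, rfl, by simp⟩
  | succ d ih =>
    intro u v hu hv h
    obtain ⟨w, hw, hw'⟩ := H.exists_backbone (H.pos u + d) (by have := H.pos_le v; omega)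
    obtain ⟨p, hp, hp'⟩ := ih hu hw hw'
    refine ⟨p.concat (H.backbone_adj hw hv (by omega)), by simp [hp], fun z hz => ?_⟩
    rw [Walk.support_concat, List.mem_append] at hz
    rcases hz with hz | hz
    · have := hp' z hz; omega
    · simp only [List.mem_singleton] at hz; subst hz; omega

theorem exists_hair_walk (w : V) : ∀ m ≤ H.height w,
    ∃ p : T.Walk (H.foot w) (H.down^[m] w), ∀ z ∈ p.support, ∃ i ≤ H.height w, H.down^[i] w = z := by
  intro m hm
  generalize hd : H.height w - m = d
  induction d generalizing m with
  | zero =>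
    obtain rfl : m = H.height w := by omega
    exact ⟨.nil, fun z hz => ⟨_, le_rfl, by simpa [foot, eq_comm] using hz⟩⟩
  | succ d ih =>
    obtain ⟨p, hp⟩ := ih (m + 1) (by omega) (by omega)
    have h1 := (H.height_iterate_down w m hm).1
    have h2 := (H.adj_down (w := H.down^[m] w) (by omega)).1
    rw [← Function.iterate_succ_apply' (f := H.down)] at h2
    refine ⟨p.concat h2.symm, fun z hz => ?_⟩
    rw [Walk.support_concat, List.mem_append] at hz
    rcases hz with hz | hz
    · exact hp z hz
    · exact ⟨m, hm, by simpa [eq_comm] using hz⟩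

theorem dist_le (hT : T.Connected) (u v : V) {d : ℕ} (h1 : H.pos u ≤ H.pos v + d)
    (h2 : H.pos v ≤ H.pos u + d) : T.dist u v ≤ H.height u + d + H.height v := by
  have hu := H.dist_iterate_down_le hT u _ le_rfl
  have hv := H.dist_iterate_down_le hT v _ le_rfl
  change T.dist (H.foot u) u ≤ _ at hu
  change T.dist (H.foot v) v ≤ _ at hv
  have h3 : T.dist (H.foot u) (H.foot v) ≤ d := by
    rcases le_total (H.pos u) (H.pos v) with h | h
    · obtain ⟨p, hp, -⟩ := H.exists_backbone_walk (H.pos v - H.pos u) (H.height_foot u)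
        (H.height_foot v) (by rw [H.pos_foot, H.pos_foot]; omega)
      exact (SimpleGraph.dist_le p).trans (by omega)
    · obtain ⟨p, hp, -⟩ := H.exists_backbone_walk (H.pos u - H.pos v) (H.height_foot v)
        (H.height_foot u) (by rw [H.pos_foot, H.pos_foot]; omega)
      rw [dist_comm]
      exact (SimpleGraph.dist_le p).trans (by omega)
  have h4 := hT.dist_triangle (u := u) (v := H.foot u) (w := v)
  have h5 := hT.dist_triangle (u := H.foot u) (v := H.foot v) (w := v)
  rw [dist_comm] at hu
  omega

variable [Fintype V]

/-- The length of the hair of `w`; for a backbone vertex, the maximum over its hairs. -/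
noncomputable def hairLen (w : V) : ℕ :=
  univ.sup fun v => if T.dist w v + H.height w = H.height v then H.height v else 0

theorem le_hairLen {w v : V} (h : T.dist w v + H.height w = H.height v) :
    H.height v ≤ H.hairLen w := by
  have := le_sup (f := fun v => if T.dist w v + H.height w = H.height v then H.height v else 0)
    (mem_univ v)
  simp only [h, if_true] at this
  exact this

theorem height_le_hairLen (w : V) : H.height w ≤ H.hairLen w :=
  H.le_hairLen (by simp)

theorem exists_top (w : V) :
    ∃ v, T.dist w v + H.height w = H.height v ∧ H.height v = H.hairLen w := by
  obtain ⟨v, -, hv⟩ := exists_mem_eq_sup univ ⟨w, mem_univ w⟩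
    (fun v => if T.dist w v + H.height w = H.height v then H.height v else 0)
  change H.hairLen w = _ at hv
  by_cases h : T.dist w v + H.height w = H.height v
  · exact ⟨v, h, by rw [hv, if_pos h]⟩
  · have := H.height_le_hairLen w
    rw [if_neg h] at hv
    exact ⟨w, by simp, by omega⟩

theorem hairLen_eq_of_adj (hT : T.Connected) {u w : V} (h : T.Adj w u)
    (hh : H.height w = H.height u + 1) (hu : H.height u ≠ 0) : H.hairLen u = H.hairLen w := by
  apply le_antisymm
  · obtain ⟨v, hv, hv'⟩ := H.exists_top u
    rw [← hv']
    by_cases hvu : v = u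
    · have := H.height_le_hairLen w
      subst hvu
      omega
    · rw [H.above_iff hT h hh hu hvu] at hv
      exact H.le_hairLen hv
  · obtain ⟨v, hv, hv'⟩ := H.exists_top w
    rw [← hv']
    rw [← H.above_iff hT h hh hu (by rintro rfl; omega)] at hv
    exact H.le_hairLen hv

end HairedPath

/-! ### Depths of combs -/

/-- The maximal depth of a vertex whose comb lies to the right of `w` within reach of `w`. Here a
vertex `v` has position `pos v`, and its comb lies within distance `2 * reach v` of this position. -/
def rightDepth [Fintype V] (pos reach depth : V → ℕ) (w : V) : ℕ :=
  univ.sup fun v =>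
    if pos w + 2 * reach v < pos v ∧ pos v + 2 * reach v ≤ pos w + 2 * reach w then depth v else 0

/-- The mirror image of `rightDepth`. -/
def leftDepth [Fintype V] (pos reach depth : V → ℕ) (w : V) : ℕ :=
  univ.sup fun v =>
    if pos v + 2 * reach v < pos w ∧ pos w + 2 * reach v ≤ pos v + 2 * reach w then depth v else 0

theorem exists_of_lt_sup_ite [Fintype V] {P : V → Prop} [DecidablePred P] {depth : V → ℕ} {k : ℕ}
    (h : k < univ.sup fun v => if P v then depth v else 0) : ∃ v, P v ∧ k < depth v := by
  obtain ⟨v, -, hv⟩ := Finset.lt_sup_iff.mp h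
  by_cases hP : P v
  · exact ⟨v, hP, by simpa [hP] using hv⟩
  · simp [hP] at hv

namespace HairedPath

variable (H : T.HairedPath) [Fintype V] {b : ℕ} {α : V → ℤ} {reach depth : V → ℕ}

/-- A vertex of depth greater than `k` forces a window of `b` consecutive positions with more than
`k` vertices of its comb: the windows of the combs to its left and to its right are too close for its
hair to fit in between, so that the hair or the backbone adds a vertex to one of the windows. -/
theorem exists_window_of_lt_depth (hα : T.IsOrdering b α) (hT : T.Connected) (hb : 0 < b)
    (hreach : ∀ w, 4 * b * reach w ≤ H.hairLen w)
    (hdepth : ∀ w, depth w = 1 + min (rightDepth H.pos reach depth w)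
      (leftDepth H.pos reach depth w)) :
    ∀ (k : ℕ) (w : V), k < depth w →
      ∃ a, H.height a = 0 ∧ H.pos a ≤ H.pos w + 2 * reach w ∧ H.pos w ≤ H.pos a + 2 * reach w ∧
        k < #{z | (H.pos z ≤ H.pos w + 2 * reach w ∧ H.pos w ≤ H.pos z + 2 * reach w) ∧
          α a - b < α z ∧ α z ≤ α a} := by
  classical
  intro k
  induction k with
  | zero =>
    intro w _
    refine ⟨H.foot w, H.height_foot w, by rw [H.pos_foot]; omega, by rw [H.pos_foot]; omega, ?_⟩
    refine card_pos.mpr ⟨H.foot w, ?_⟩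
    rw [mem_filter, H.pos_foot]
    refine ⟨mem_univ _, ⟨by omega, by omega⟩, by omega, le_rfl⟩
  | succ k ih =>
    intro w hw
    rw [hdepth w] at hw
    obtain ⟨r, ⟨hr1, hr2⟩, hrk⟩ := exists_of_lt_sup_ite
      (show k < rightDepth H.pos reach depth w by omega)
    obtain ⟨l, ⟨hl1, hl2⟩, hlk⟩ := exists_of_lt_sup_ite
      (show k < leftDepth H.pos reach depth w by omega)
    obtain ⟨ar, har, har1, har2, har3⟩ := ih r hrk
    obtain ⟨al, hal, hal1, hal2, hal3⟩ := ih l hlk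
    obtain ⟨v, hv, hv'⟩ := H.exists_top w
    -- The hair of `w`, with its foot.
    set S : Finset V := (range (H.height v + 1)).image fun i => H.down^[i] v with hS
    have hvw : H.pos v = H.pos w := by
      have h := ((H.dist_add_height_iff hT).mp hv).2
      rw [← (H.height_iterate_down v (H.height v - H.height w) (by omega)).2, h]
    have hSmem : ∀ z ∈ S, H.pos z = H.pos w := by
      intro z hz
      obtain ⟨i, hi, rfl⟩ := mem_image.mp hz
      rw [(H.height_iterate_down v i (by rw [mem_range] at hi; omega)).2, hvw]
    have hScard : #S = H.height v + 1 := by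
      rw [hS, card_image_of_injOn, card_range]
      intro i hi j hj hij
      rw [mem_coe, mem_range] at hi hj
      have h1 := (H.height_iterate_down v i (by omega)).1
      have h2 := (H.height_iterate_down v j (by omega)).1
      simp only at hij
      rw [hij] at h1
      omega
    have hSwalk : ∀ z ∈ S, ∃ p : T.Walk (H.foot v) z, ∀ u ∈ p.support, u ∈ S := by
      intro z hz
      obtain ⟨i, hi, rfl⟩ := mem_image.mp hz
      obtain ⟨p, hp⟩ := H.exists_hair_walk v i (by rw [mem_range] at hi; omega)
      refine ⟨p, fun u hu => ?_⟩
      obtain ⟨j, hj, rfl⟩ := hp u hu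
      exact mem_image_of_mem _ (mem_range.mpr (by omega))
    have hfoot : H.pos (H.foot v) = H.pos w := by rw [H.pos_foot, hvw]
    obtain ⟨p, hp, hp'⟩ := H.exists_backbone_walk (H.pos w - H.pos al) hal (H.height_foot v)
      (by omega)
    obtain ⟨q, hq, hq'⟩ := H.exists_backbone_walk (H.pos ar - H.pos w) (H.height_foot v) har
      (by omega)
    have hlen : (α ar ≤ α al + #S) ∧ (α al ≤ α ar + #S) := by
      have h1 := hα.le_add_length (p.append q)
      have h2 := hα.le_add_length (p.append q).reverse
      rw [Walk.length_reverse] at h2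
      rw [Walk.length_append, hp, hq] at h1 h2
      have h3 : b * (H.pos w - H.pos al + (H.pos ar - H.pos w)) ≤ #S := by
        rw [hScard, hv']
        refine le_trans ?_ ((hreach w).trans (Nat.le_succ _))
        rw [mul_comm 4 b, mul_assoc]
        exact Nat.mul_le_mul_left _ (by omega)
      zify at h3
      push_cast at h1 h2
      omega
    have finish_r : ∀ z, H.pos z ≤ H.pos w → H.pos w ≤ H.pos z + 2 * reach w →
        α ar - b < α z → α z ≤ α ar → k + 1 < #{z | (H.pos z ≤ H.pos w + 2 * reach w ∧
          H.pos w ≤ H.pos z + 2 * reach w) ∧ α ar - b < α z ∧ α z ≤ α ar} := by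
      intro z h1 h2 h3 h4
      refine lt_of_lt_of_le (Nat.succ_lt_succ har3) ?_
      rw [Nat.succ_eq_add_one, ← card_insert_of_notMem (a := z)]
      · refine card_le_card fun y hy => ?_
        rw [mem_insert, mem_filter] at hy
        rw [mem_filter]
        rcases hy with rfl | ⟨-, ⟨h5, h6⟩, h7⟩
        · exact ⟨mem_univ _, ⟨by omega, h2⟩, h3, h4⟩
        · exact ⟨mem_univ _, ⟨by omega, by omega⟩, h7⟩
      · rw [mem_filter]
        rintro ⟨-, ⟨h5, h6⟩, h7⟩
        omega
    have finish_l : ∀ z, H.pos w ≤ H.pos z → H.pos z ≤ H.pos w + 2 * reach w →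
        α al - b < α z → α z ≤ α al → k + 1 < #{z | (H.pos z ≤ H.pos w + 2 * reach w ∧
          H.pos w ≤ H.pos z + 2 * reach w) ∧ α al - b < α z ∧ α z ≤ α al} := by
      intro z h1 h2 h3 h4
      refine lt_of_lt_of_le (Nat.succ_lt_succ hal3) ?_
      rw [Nat.succ_eq_add_one, ← card_insert_of_notMem (a := z)]
      · refine card_le_card fun y hy => ?_
        rw [mem_insert, mem_filter] at hy
        rw [mem_filter]
        rcases hy with rfl | ⟨-, ⟨h5, h6⟩, h7⟩
        · exact ⟨mem_univ _, ⟨h2, by omega⟩, h3, h4⟩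
        · exact ⟨mem_univ _, ⟨by omega, by omega⟩, h7⟩
      · rw [mem_filter]
        rintro ⟨-, ⟨h5, h6⟩, h7⟩
        omega
    have conclude : (∃ z, (z ∈ q.support ∨ z ∈ S) ∧ α al - b < α z ∧ α z ≤ α al) ∨
        (∃ z, (z ∈ p.reverse.support ∨ z ∈ S) ∧ α ar - b < α z ∧ α z ≤ α ar) := by
      have hne : α al ≠ α ar := fun h => by
        rw [hα.injective h] at hal1
        omega
      rcases lt_or_gt_of_ne hne with h | h
      · exact hα.exists_crossing hb h p.reverse q S hSwalk hlen.1
      · exact (hα.exists_crossing hb h q p.reverse S hSwalk hlen.2).symm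
    rcases conclude with ⟨z, hz, hz1, hz2⟩ | ⟨z, hz, hz1, hz2⟩
    · refine ⟨al, hal, by omega, by omega, finish_l z ?_ ?_ hz1 hz2⟩
      all_goals
        rcases hz with hz | hz
        · have := hq' z hz; omega
        · have := hSmem z hz; omega
    · refine ⟨ar, har, by omega, by omega, finish_r z ?_ ?_ hz1 hz2⟩
      all_goals
        rcases hz with hz | hz
        · rw [Walk.support_reverse, List.mem_reverse] at hz
          have := hp' z hz; omega
        · have := hSmem z hz; omega

/-- The depth is a lower bound for the bandwidth. -/
theorem depth_le (hα : T.IsOrdering b α) (hT : T.Connected) (hb : 0 < b)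
    (hreach : ∀ w, 4 * b * reach w ≤ H.hairLen w)
    (hdepth : ∀ w, depth w = 1 + min (rightDepth H.pos reach depth w)
      (leftDepth H.pos reach depth w)) (w : V) : depth w ≤ b := by
  classical
  by_contra! hw
  obtain ⟨a, -, -, -, ha⟩ := H.exists_window_of_lt_depth hα hT hb hreach hdepth b w hw
  have h : #(Finset.image α {z | (H.pos z ≤ H.pos w + 2 * reach w ∧
      H.pos w ≤ H.pos z + 2 * reach w) ∧ α a - b < α z ∧ α z ≤ α a}) ≤
      #(Ioc (α a - b) (α a)) := by
    refine card_le_card fun z hz => ?_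
    obtain ⟨v, hv, rfl⟩ := mem_image.mp hz
    rw [mem_filter] at hv
    exact mem_Ioc.mpr hv.2.2
  rw [card_image_of_injective _ hα.injective, Int.card_Ioc] at h
  omega

/-- Hairs of length at least `m` that are attached within distance `d` of each other are few, as
their lowest `m` vertices are close together. -/
theorem card_image_root_mul_le [DecidableEq V] (hα : T.IsOrdering b α) (hT : T.Connected)
    (X : Finset V) {m d : ℕ} (h0 : ∀ w ∈ X, H.height w ≠ 0) (hm : ∀ w ∈ X, m ≤ H.hairLen w)
    (hd : ∀ u ∈ X, ∀ v ∈ X, H.pos u ≤ H.pos v + d) :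
    #(X.image H.root) * m ≤ b * (d + 2 * m) := by
  rcases X.eq_empty_or_nonempty with rfl | ⟨w0, hw0⟩
  · simp
  set Z : Finset V := {v | H.height v ≠ 0 ∧ H.height v ≤ m ∧ H.root v ∈ X.image H.root} with hZ
  have hpos : ∀ v ∈ insert (H.foot w0) Z, H.height v ≤ m ∧ ∃ w ∈ X, H.pos v = H.pos w := by
    intro v hv
    rcases mem_insert.mp hv with rfl | hv
    · exact ⟨by rw [H.height_foot]; omega, w0, hw0, H.pos_foot w0⟩
    · rw [hZ, mem_filter] at hv
      obtain ⟨w, hw, hwv⟩ := mem_image.mp hv.2.2.2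
      exact ⟨hv.2.2.1, w, hw, by rw [← H.pos_root v, ← hwv, H.pos_root]⟩
  have h1 := hα.card_le hT (insert (H.foot w0) Z) (d + 2 * m) (by
    intro u hu v hv
    obtain ⟨hu1, u', hu', hu2⟩ := hpos u hu
    obtain ⟨hv1, v', hv', hv2⟩ := hpos v hv
    have h2 := hd u' hu' v' hv'
    have h3 := hd v' hv' u' hu'
    exact (H.dist_le hT u v (d := d) (by omega) (by omega)).trans (by omega))
  rw [card_insert_of_notMem (by rw [hZ, mem_filter, H.height_foot]; simp)] at h1
  refine le_trans ?_ (Nat.le_of_succ_le_succ h1)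
  rw [card_eq_sum_card_fiberwise (f := H.root) (t := X.image H.root) (s := Z)
    (fun v hv => by rw [mem_coe, hZ, mem_filter] at hv; exact mem_coe.mpr hv.2.2.2)]
  rw [← smul_eq_mul]
  refine card_nsmul_le_sum _ _ _ fun r hr => ?_
  obtain ⟨w, hw, rfl⟩ := mem_image.mp hr
  obtain ⟨v, hv, hv'⟩ := H.exists_top w
  rw [H.dist_add_height_iff hT] at hv
  have hmw := hm w hw
  have hw0' := h0 w hw
  have hroot : H.root v = H.root w := by
    rw [← H.root_iterate_down (w := v) (m := H.height v - H.height w) (by omega), hv.2]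
  rw [← card_range m]
  refine card_le_card_of_injOn (fun i => H.down^[H.height v - (i + 1)] v) ?_ ?_
  · intro i hi
    rw [mem_coe, mem_range] at hi
    have h3 := (H.height_iterate_down v (H.height v - (i + 1)) (by omega)).1
    have h4 : H.root (H.down^[H.height v - (i + 1)] v) = H.root w := by
      rw [H.root_iterate_down (by omega), hroot]
    have h5 : H.height (H.down^[H.height v - (i + 1)] v) = i + 1 := by omega
    exact mem_coe.mpr (mem_filter.mpr ⟨mem_filter.mpr ⟨mem_univ _, (by rw [h5]; omega),
      (by rw [h5]; omega), by rw [h4]; exact hr⟩, h4⟩)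
  · intro i hi j hj hij
    rw [mem_coe, mem_range] at hi hj
    have h3 := (H.height_iterate_down v (H.height v - (i + 1)) (by omega)).1
    have h4 := (H.height_iterate_down v (H.height v - (j + 1)) (by omega)).1
    simp only at hij
    rw [hij] at h3
    omega

end HairedPath

/-- If `g w > 3 * reach v` forces `w` to be deeper than `v`, then a set is covered by one group
`{w | g w ≤ 3 * m ≤ 3 * reach w}` for each depth. -/
theorem card_le_depth_mul {X : Finset V} {reach g depth : V → ℕ} {K b : ℕ}
    (h1 : ∀ m, #{w ∈ X | g w ≤ 3 * m ∧ m ≤ reach w} ≤ K)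
    (h2 : ∀ w ∈ X, ∀ v ∈ X, 3 * reach v < g w → depth v < depth w)
    (h3 : ∀ w ∈ X, 1 ≤ depth w ∧ depth w ≤ b) : #X ≤ b * K := by
  classical
  have key : ∀ j ≤ b, #{w ∈ X | b < depth w + j} ≤ j * K := by
    intro j
    induction j with
    | zero =>
      intro _
      rw [filter_eq_empty_iff.mpr fun w hw => by have := h3 w hw; omega]
      simp
    | succ j ih =>
      intro hj
      rcases ({w ∈ X | b < depth w + (j + 1)} : Finset V).eq_empty_or_nonempty with he | hne
      · rw [he]; simp
      obtain ⟨v, hv, hmin⟩ := exists_min_image _ reach hne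
      rw [mem_filter] at hv
      have hsub : ({w ∈ X | b < depth w + (j + 1)} : Finset V) ⊆
          {w ∈ X | b < depth w + j} ∪ {w ∈ X | g w ≤ 3 * reach v ∧ reach v ≤ reach w} := by
        intro w hw
        have hw' := hmin w hw
        rw [mem_filter] at hw
        rw [mem_union, mem_filter, mem_filter]
        by_cases hg : g w ≤ 3 * reach v
        · exact .inr ⟨hw.1, hg, hw'⟩
        · have := h2 w hw.1 v hv.1 (by omega)
          exact .inl ⟨hw.1, by omega⟩
      have h4 := (card_le_card hsub).trans (card_union_le _ _)
      have h5 := ih (by omega)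
      have h6 := h1 (reach v)
      rw [Nat.add_mul]
      omega
  have := key b le_rfl
  rwa [filter_true_of_mem fun w hw => by have := h3 w hw; omega] at this

namespace HairedPath

variable (H : T.HairedPath) [Fintype V] {b : ℕ} {α : V → ℤ} {reach depth : V → ℕ}

/-- The vertices of the hairs that are folded in one direction and meet one bucket. The distance
between the bucket and the position of `w` is `g w`. -/
theorem card_bucket_le (hα : T.IsOrdering b α) (hT : T.Connected)
    {X : Finset V} {g : V → ℕ} (hreach : ∀ w, reach w = H.hairLen w / (4 * b)) (hb : 0 < b)
    (h0 : ∀ w ∈ X, H.height w ≠ 0) (hg : ∀ w ∈ X, g w = H.height w / (4 * b))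
    (hpos : ∀ u ∈ X, ∀ v ∈ X, H.pos u + g u = H.pos v + g v ∨ H.pos u + g v = H.pos v + g u)
    (h2 : ∀ w ∈ X, ∀ v ∈ X, 3 * reach v < g w → depth v < depth w)
    (h3 : ∀ w ∈ X, 1 ≤ depth w ∧ depth w ≤ b) : #X ≤ 8 * b ^ 3 := by
  classical
  have hfiber : ∀ Y ⊆ X, #Y ≤ 4 * b * #(Y.image H.root) := by
    intro Y hY
    refine card_le_mul_card_image Y (4 * b) fun r hr => ?_
    rw [← card_range (4 * b)]
    refine card_le_card_of_injOn (fun w => H.height w % (4 * b)) ?_ ?_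
    · intro w _
      rw [mem_coe, mem_range]
      exact Nat.mod_lt _ (by omega)
    · intro u hu v hv huv
      rw [mem_coe, mem_filter] at hu hv
      have h4 : H.pos u = H.pos v := by rw [← H.pos_root u, hu.2, ← hv.2, H.pos_root]
      have h5 : g u = g v := by
        have := hpos u (hY hu.1) v (hY hv.1)
        omega
      have h6 : H.height u = H.height v := by
        rw [← Nat.div_add_mod (H.height u) (4 * b), ← Nat.div_add_mod (H.height v) (4 * b),
          ← hg u (hY hu.1), ← hg v (hY hv.1), h5]
        simp only at huv
        rw [huv]
      have h7 := h0 u (hY hu.1)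
      exact H.eq_of_root_eq (H.height u - 1) (by omega) (by omega) (by rw [hu.2, hv.2])
  have hgroup : ∀ m, #{w ∈ X | g w ≤ 3 * m ∧ m ≤ reach w} ≤ 8 * b ^ 2 := by
    intro m
    set Y := {w ∈ X | g w ≤ 3 * m ∧ m ≤ reach w} with hY
    have hYX : Y ⊆ X := filter_subset _ _
    have h4 := H.card_image_root_mul_le hα hT Y (m := max 1 (4 * b * m)) (d := 3 * m)
      (fun w hw => h0 w (hYX hw)) ?_ ?_
    · set N := #(Y.image H.root)
      set l := max 1 (4 * b * m)
      have hl1 : 1 ≤ l := le_max_left _ _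
      have hl2 : 4 * b * m ≤ l := le_max_right _ _
      have h5 : (4 * N) * l ≤ (3 + 8 * b) * l := by nlinarith
      have h6 := Nat.le_of_mul_le_mul_right h5 (by omega)
      have h7 : N ≤ 2 * b := by omega
      calc #Y ≤ 4 * b * N := hfiber Y hYX
        _ ≤ 4 * b * (2 * b) := Nat.mul_le_mul_left _ h7
        _ = 8 * b ^ 2 := by ring
    · intro w hw
      rw [hY, mem_filter] at hw
      have h5 := H.height_le_hairLen w
      have h6 := h0 w hw.1
      have h7 : 4 * b * m ≤ H.hairLen w := by
        rw [mul_comm, ← Nat.le_div_iff_mul_le (by omega), ← hreach]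
        exact hw.2.2
      exact max_le (by omega) h7
    · intro u hu v hv
      rw [hY, mem_filter] at hu hv
      have := hpos u hu.1 v hv.1
      omega
  calc #X ≤ b * (8 * b ^ 2) := card_le_depth_mul hgroup h2 h3
    _ = 8 * b ^ 3 := by ring

end HairedPath

end SimpleGraph

namespace SimpleGraph

open Finset

/-! ### Layouts from buckets -/

/-- The layout that lists the vertices by increasing key, and by index for equal keys. -/
def rankLayout {n : ℕ} (key : Fin n → ℕ) (w : Fin n) : ℕ :=
  1 + #{v | key v < key w ∨ key v = key w ∧ v < w}

section RankLayout

variable {n : ℕ} (key : Fin n → ℕ)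

theorem rankLayout_lt {u w : Fin n} (h : key u < key w ∨ key u = key w ∧ u < w) :
    rankLayout key u < rankLayout key w := by
  refine Nat.add_lt_add_left (card_lt_card ?_) 1
  rw [ssubset_iff_of_subset fun v hv => ?_]
  · exact ⟨u, mem_filter.mpr ⟨mem_univ _, h⟩, by simp⟩
  · rw [mem_filter] at hv ⊢
    exact ⟨mem_univ _, by omega⟩

theorem rankLayout_injective : Function.Injective (rankLayout key) := by
  intro u w h
  by_contra hne
  rcases (by omega : (key u < key w ∨ key u = key w ∧ u < w) ∨
      (key w < key u ∨ key w = key u ∧ w < u)) with h' | h'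
  · exact absurd h (rankLayout_lt key h').ne
  · exact absurd h (rankLayout_lt key h').ne'

theorem isLayout_rankLayout : IsLayout (rankLayout key) := by
  have hsub : univ.image (rankLayout key) ⊆ Icc 1 n := by
    intro z hz
    obtain ⟨w, -, rfl⟩ := mem_image.mp hz
    rw [mem_Icc]
    have : #{v | key v < key w ∨ key v = key w ∧ v < w} < n := by
      refine (card_lt_univ_of_notMem (x := w) (by simp)).trans_eq (Fintype.card_fin n)
    unfold rankLayout
    omega
  have heq := eq_of_subset_of_card_le hsub
    (by rw [card_image_of_injective _ (rankLayout_injective key)]; simp)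
  refine ⟨fun w _ => ?_, (rankLayout_injective key).injOn, fun z hz => ?_⟩
  · simpa using hsub (mem_image_of_mem _ (mem_univ w))
  · have : z ∈ univ.image (rankLayout key) := by rw [heq]; simpa using hz
    obtain ⟨w, -, rfl⟩ := mem_image.mp this
    exact ⟨w, Set.mem_univ _, rfl⟩

theorem layoutBandwidth_le_iff {V : Type*} [Fintype V] {T : SimpleGraph V} {α : V → ℕ} {k : ℕ} :
    layoutBandwidth T α ≤ k ↔
      ∀ u v, T.Adj u v → ((α u : ℤ) - (α v : ℤ)).natAbs ≤ k := by
  classical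
  unfold layoutBandwidth
  rw [Finset.sup_le_iff]
  constructor
  · intro h u v huv
    simpa [huv] using h (u, v) (mem_univ _)
  · rintro h ⟨u, v⟩ -
    by_cases huv : T.Adj u v
    · simpa [huv] using h u v huv
    · simp [huv]

theorem exists_isOrdering {T : SimpleGraph (Fin n)} {b : ℕ} (h : bandwidth T ≤ b) :
    ∃ α : Fin n → ℤ, T.IsOrdering b α := by
  obtain ⟨α, hα, hα'⟩ := Nat.sInf_mem (s := {k : ℕ | ∃ α : Fin n → ℕ, IsLayout α ∧
    layoutBandwidth T α = k}) ⟨_, _, isLayout_rankLayout fun _ => 0, rfl⟩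
  change layoutBandwidth T α = bandwidth T at hα'
  rw [← hα', layoutBandwidth_le_iff] at h
  refine ⟨fun v => α v, fun u v huv => ?_, fun {u v} huv => ?_⟩
  · exact hα.2.1 (Set.mem_univ _) (Set.mem_univ _) (by exact_mod_cast huv)
  · have := h u v huv
    change (α v : ℤ) ≤ α u + b
    omega

/-- Neighbours in equal or consecutive buckets are at distance less than twice the bucket size. -/
theorem layoutBandwidth_rankLayout_le {T : SimpleGraph (Fin n)} {M : ℕ}
    (hadj : ∀ {u w}, T.Adj u w → key w ≤ key u + 1) (hM : ∀ k, #{w | key w = k} ≤ M) :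
    layoutBandwidth T (rankLayout key) ≤ 2 * M - 1 := by
  rw [layoutBandwidth_le_iff]
  have of_before : ∀ u w, T.Adj u w → (key u < key w ∨ key u = key w ∧ u < w) →
      rankLayout key w ≤ rankLayout key u + (2 * M - 1) := by
    intro u w huw hlt
    have h1 := hadj huw
    have hsub : insert w ({v | key v < key w ∨ key v = key w ∧ v < w} : Finset (Fin n)) ⊆
        ({v | key v < key u ∨ key v = key u ∧ v < u} : Finset (Fin n)) ∪
          (({v | key v = key u} : Finset (Fin n)) ∪ ({v | key v = key w} : Finset (Fin n))) := by
      intro v hv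
      simp only [mem_insert, mem_filter, mem_union, mem_univ, true_and] at hv ⊢
      rcases hv with rfl | hv <;> omega
    have h2 := card_le_card hsub
    rw [card_insert_of_notMem (by simp)] at h2
    have h3 := card_union_le ({v | key v < key u ∨ key v = key u ∧ v < u} : Finset (Fin n))
      (({v | key v = key u} : Finset (Fin n)) ∪ ({v | key v = key w} : Finset (Fin n)))
    have h4 := card_union_le ({v | key v = key u} : Finset (Fin n))
      ({v | key v = key w} : Finset (Fin n))
    have h5 := hM (key u)
    have h6 := hM (key w)
    unfold rankLayout
    omega
  intro u w huw
  have hne := huw.ne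
  rcases (by omega : (key u < key w ∨ key u = key w ∧ u < w) ∨
      (key w < key u ∨ key w = key u ∧ w < u)) with h | h
  · have h1 := of_before u w huw h
    have h2 := rankLayout_lt key h
    omega
  · have h1 := of_before w u huw.symm h
    have h2 := rankLayout_lt key h
    omega

end RankLayout

namespace HairedPath

variable {V : Type*} [Fintype V]

/-- The bucket of a vertex: its hair is folded along the backbone, with `4 * b` vertices in each
bucket, to the side on which there is no deeper comb than on the other side. Positions are shifted by
`N` to make room on the left. -/
def bucket (N b : ℕ) (pos height reach depth : V → ℕ) (w : V) : ℕ :=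
  if rightDepth pos reach depth w ≤ leftDepth pos reach depth w then
    N + pos w + height w / (4 * b)
  else N + pos w - height w / (4 * b)

theorem depthFns_congr {pos reach depth : V → ℕ} {u w : V} (hp : pos u = pos w)
    (hr : reach u = reach w) :
    rightDepth pos reach depth u = rightDepth pos reach depth w ∧
      leftDepth pos reach depth u = leftDepth pos reach depth w := by
  unfold rightDepth leftDepth
  rw [hp, hr]
  exact ⟨rfl, rfl⟩

theorem le_rightDepth {pos reach depth : V → ℕ} {v w : V} (h1 : pos w + 2 * reach v < pos v)
    (h2 : pos v + 2 * reach v ≤ pos w + 2 * reach w) :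
    depth v ≤ rightDepth pos reach depth w := by
  have := le_sup (f := fun v => if pos w + 2 * reach v < pos v ∧
    pos v + 2 * reach v ≤ pos w + 2 * reach w then depth v else 0) (mem_univ v)
  simp only [h1, h2, and_self, if_true] at this
  exact this

theorem le_leftDepth {pos reach depth : V → ℕ} {v w : V} (h1 : pos v + 2 * reach v < pos w)
    (h2 : pos w + 2 * reach v ≤ pos v + 2 * reach w) :
    depth v ≤ leftDepth pos reach depth w := by
  have := le_sup (f := fun v => if pos v + 2 * reach v < pos w ∧
    pos w + 2 * reach v ≤ pos v + 2 * reach w then depth v else 0) (mem_univ v)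
  simp only [h1, h2, and_self, if_true] at this
  exact this

variable {T : SimpleGraph V} (H : T.HairedPath) {N b : ℕ} {reach depth : V → ℕ}

theorem bucket_le_of_adj (hT : T.Connected) (hN : ∀ w, H.height w ≤ N) (hb : 0 < b)
    (hreach : ∀ w, reach w = H.hairLen w / (4 * b)) {u w : V} (h : T.Adj u w) :
    bucket N b H.pos H.height reach depth w ≤ bucket N b H.pos H.height reach depth u + 1 := by
  have hdiv : ∀ v, H.height v / (4 * b) ≤ N := fun v => (Nat.div_le_self _ _).trans (hN v)
  have key : ∀ {x y}, T.Adj y x → H.height y = H.height x + 1 → H.pos x = H.pos y →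
      bucket N b H.pos H.height reach depth y ≤ bucket N b H.pos H.height reach depth x + 1 ∧
      bucket N b H.pos H.height reach depth x ≤ bucket N b H.pos H.height reach depth y + 1 := by
    intro x y hyx hh hpos
    have hx := hdiv x
    have hy := hdiv y
    have h1 : H.height x / (4 * b) ≤ H.height y / (4 * b) := Nat.div_le_div_right (by omega)
    have h2 : H.height y / (4 * b) ≤ H.height x / (4 * b) + 1 := by
      rw [← Nat.add_div_right _ (by omega)]
      exact Nat.div_le_div_right (by omega)
    by_cases h0 : H.height x = 0
    · have h3 : H.height y / (4 * b) = 0 := Nat.div_eq_of_lt (by omega)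
      unfold bucket
      rw [h0, Nat.zero_div] at *
      split <;> split <;> omega
    · have h3 : reach x = reach y := by
        rw [hreach, hreach, H.hairLen_eq_of_adj hT hyx hh h0]
      obtain ⟨h4, h5⟩ := depthFns_congr (depth := depth) hpos h3
      unfold bucket
      rw [h4, h5]
      split <;> omega
  rcases H.adj_cases h with ⟨h1, h2, h3⟩ | ⟨h1, h2 | h2⟩
  · unfold bucket
    rw [h1, h2, Nat.zero_div]
    split <;> split <;> omega
  · exact (key h.symm h2 h1).1
  · exact (key h h2 h1.symm).2

theorem card_bucket_eq_le {α : V → ℤ} (hα : T.IsOrdering b α) (hT : T.Connected)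
    (hN : ∀ w, H.height w ≤ N) (hb : 0 < b) (hreach : ∀ w, reach w = H.hairLen w / (4 * b))
    (hdepth : ∀ w, depth w = 1 + min (rightDepth H.pos reach depth w)
      (leftDepth H.pos reach depth w)) (k : ℕ) :
    #{w | bucket N b H.pos H.height reach depth w = k} ≤ 16 * b ^ 3 + 1 := by
  classical
  have hdiv : ∀ v, H.height v / (4 * b) ≤ N := fun v => (Nat.div_le_self _ _).trans (hN v)
  have hgr : ∀ v, H.height v / (4 * b) ≤ reach v := fun v => by
    rw [hreach]; exact Nat.div_le_div_right (H.height_le_hairLen v)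
  have hb3 : ∀ w, 1 ≤ depth w ∧ depth w ≤ b := fun w =>
    ⟨by rw [hdepth]; omega, H.depth_le hα hT hb
      (fun w => by rw [hreach, mul_comm]; exact Nat.div_mul_le_self _ _) hdepth w⟩
  set P : V → Prop := fun w => rightDepth H.pos reach depth w ≤ leftDepth H.pos reach depth w
  have hsub : ({w | bucket N b H.pos H.height reach depth w = k} : Finset V) ⊆
      ({w | H.height w = 0 ∧ N + H.pos w = k} : Finset V) ∪
      (({w | H.height w ≠ 0 ∧ P w ∧ N + H.pos w + H.height w / (4 * b) = k} : Finset V) ∪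
       ({w | H.height w ≠ 0 ∧ ¬ P w ∧ N + H.pos w = k + H.height w / (4 * b)} : Finset V)) := by
    intro w hw
    have h1 := hdiv w
    simp only [mem_filter, mem_union, mem_univ, true_and] at hw ⊢
    unfold bucket at hw
    by_cases h0 : H.height w = 0
    · left
      rw [h0, Nat.zero_div] at hw
      split at hw <;> omega
    · right
      by_cases hP : P w
      · rw [if_pos hP] at hw
        exact .inl ⟨h0, hP, hw⟩
      · rw [if_neg hP] at hw
        exact .inr ⟨h0, hP, by omega⟩
  have h1 := (card_le_card hsub).trans ((card_union_le _ _).trans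
    (Nat.add_le_add_left (card_union_le _ _) _))
  have h2 : #{w | H.height w = 0 ∧ N + H.pos w = k} ≤ 1 := by
    rw [card_le_one]
    intro u hu v hv
    rw [mem_filter] at hu hv
    exact H.backbone_unique hu.2.1 hv.2.1 (by omega)
  have h3 := H.card_bucket_le hα hT (depth := depth) (g := fun w => H.height w / (4 * b))
    (X := {w | H.height w ≠ 0 ∧ P w ∧ N + H.pos w + H.height w / (4 * b) = k}) hreach hb
    (fun w hw => (mem_filter.mp hw).2.1) (fun _ _ => rfl) (by
      intro u hu v hv
      rw [mem_filter] at hu hv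
      exact .inl (by omega)) (by
      intro w hw v hv hlt
      rw [mem_filter] at hw hv
      have h4 := hgr w
      have h5 := hgr v
      have h6 : depth v ≤ rightDepth H.pos reach depth w := by
        have h7 := Nat.zero_le (H.height v / (4 * b))
        apply le_rightDepth <;> omega
      have h7 := hdepth w
      have h8 : rightDepth H.pos reach depth w ≤ leftDepth H.pos reach depth w := hw.2.2.1
      omega) (fun w _ => hb3 w)
  have h4 := H.card_bucket_le hα hT (depth := depth) (g := fun w => H.height w / (4 * b))
    (X := {w | H.height w ≠ 0 ∧ ¬ P w ∧ N + H.pos w = k + H.height w / (4 * b)}) hreach hb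
    (fun w hw => (mem_filter.mp hw).2.1) (fun _ _ => rfl) (by
      intro u hu v hv
      rw [mem_filter] at hu hv
      exact .inr (by omega)) (by
      intro w hw v hv hlt
      rw [mem_filter] at hw hv
      have h4 := hgr w
      have h5 := hgr v
      have h6 : depth v ≤ leftDepth H.pos reach depth w := by
        have h7 := Nat.zero_le (H.height v / (4 * b))
        apply le_leftDepth <;> omega
      have h7 := hdepth w
      have h8 : ¬ rightDepth H.pos reach depth w ≤ leftDepth H.pos reach depth w := hw.2.2.1
      omega) (fun w _ => hb3 w)
  omega

end HairedPath

theorem HairedPath.layoutBandwidth_le {n : ℕ} {T : SimpleGraph (Fin n)} (H : T.HairedPath)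
    {N b : ℕ} {reach depth : Fin n → ℕ} (hT : T.Connected) (hbw : bandwidth T ≤ b)
    (hN : ∀ w, H.height w ≤ N) (hb : 0 < b) (hreach : ∀ w, reach w = H.hairLen w / (4 * b))
    (hdepth : ∀ w, depth w = 1 + min (rightDepth H.pos reach depth w)
      (leftDepth H.pos reach depth w)) :
    layoutBandwidth T (rankLayout (bucket N b H.pos H.height reach depth)) ≤ 48 * b ^ 3 := by
  obtain ⟨α, hα⟩ := exists_isOrdering hbw
  have h := layoutBandwidth_rankLayout_le (bucket N b H.pos H.height reach depth)
    (H.bucket_le_of_adj hT hN hb hreach) (H.card_bucket_eq_le hα hT hN hb hreach hdepth)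
  have : 1 ≤ b ^ 3 := Nat.one_le_pow _ _ hb
  omega

end SimpleGraph

namespace LoopLang

open Finset WordRAM

/-! ### Reasoning about loop programs -/

instance : Add Term := ⟨.op .add⟩
instance : Sub Term := ⟨.op .sub⟩
instance : Mul Term := ⟨.op .mul⟩

/-- The term that is `1` if `e < f` and `0` otherwise. -/
def Term.lt (e f : Term) : Term := .op .lt e f

/-- The term that is `1` if `e = f` and `0` otherwise. -/
def Term.eq (e f : Term) : Term := .op .eq e f

/-- The minimum, by truncated subtraction. -/
def Term.min (e f : Term) : Term := e - (e - f)

/-- The quotient of `e` by `m`, for terms without the variable `5`: the number of `i < N` with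
`m * (i + 1) ≤ e`. -/
def Term.quot (e m : Term) : Term :=
  .agg .sum 5 ((m * (.var 5 + .const 1)).lt (e + .const 1))

/-- The entry `(i, j)` of a matrix stored row by row. -/
def Term.entry (a : ℕ) (i j : Term) : Term := .get a (i * .var 0 + j)

section Val

variable {N : ℕ} {A : ℕ → ℕ → ℕ} {env : ℕ → ℕ} (e f : Term)

theorem Term.val_const (k : ℕ) : (Term.const k).val N A env = k := rfl

theorem Term.val_var (x : ℕ) : (Term.var x).val N A env = env x := rfl

theorem Term.val_get (a : ℕ) : (Term.get a e).val N A env = A a (e.val N A env) := rfl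

theorem Term.val_add : (e + f).val N A env = e.val N A env + f.val N A env := rfl

theorem Term.val_sub : (e - f).val N A env = e.val N A env - f.val N A env := rfl

theorem Term.val_mul : (e * f).val N A env = e.val N A env * f.val N A env := rfl

theorem Term.val_lt : (e.lt f).val N A env = if e.val N A env < f.val N A env then 1 else 0 := rfl

theorem Term.val_eq : (e.eq f).val N A env = if e.val N A env = f.val N A env then 1 else 0 := rfl

theorem Term.val_min : (e.min f).val N A env = Min.min (e.val N A env) (f.val N A env) := by
  simp only [Term.min, Term.val_sub]
  omega

theorem Term.val_entry (a : ℕ) :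
    (Term.entry a e f).val N A env = A a (e.val N A env * env 0 + f.val N A env) := rfl

theorem Term.val_sum (x : ℕ) :
    (Term.agg .sum x e).val N A env = ∑ i : Fin N, e.val N A (Function.update env x i) := by
  rw [← Finset.sum_range (fun i => e.val N A (Function.update env x i))]
  simp only [Term.val]
  have : ∀ m, (Nat.rec 0 (fun i acc => Agg.sum.step acc (e.val N A (Function.update env x i))) m
      : ℕ) = ∑ i ∈ range m, e.val N A (Function.update env x i) := by
    intro m
    induction m with
    | zero => rfl
    | succ m ih => rw [sum_range_succ, ← ih]; rfl
  exact this N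

theorem Term.val_sup (x : ℕ) :
    (Term.agg .sup x e).val N A env =
      univ.sup fun i : Fin N => e.val N A (Function.update env x i) := by
  have : ∀ m, (Nat.rec 0 (fun i acc => Agg.sup.step acc (e.val N A (Function.update env x i))) m
      : ℕ) = univ.sup fun i : Fin m => e.val N A (Function.update env x i) := by
    intro m
    induction m with
    | zero => rfl
    | succ m ih =>
      rw [Fin.univ_castSuccEmb, sup_cons, sup_map]
      simp only [Fin.val_last, Function.comp_def, Fin.coe_castSuccEmb, Fin.val_castSucc]
      rw [← ih]
      simp only [Agg.step]
      generalize (Nat.rec 0 _ m : ℕ) = r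
      omega
  exact this N

end Val

theorem sum_ite_mul_succ_le {N m e : ℕ} (hm : 0 < m) (he : e / m ≤ N) :
    (∑ i : Fin N, if m * ((i : ℕ) + 1) < e + 1 then 1 else 0) = e / m := by
  rw [Finset.sum_range (fun i => if m * (i + 1) < e + 1 then 1 else 0) |>.symm, ← card_filter]
  have : ({i ∈ range N | m * (i + 1) < e + 1} : Finset ℕ) = range (e / m) := by
    ext i
    rw [mem_filter, mem_range, mem_range, Nat.lt_succ_iff, mul_comm, ← Nat.le_div_iff_mul_le hm]
    omega
  rw [this, card_range]

/-- Whether a statement writes to array `a`. -/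
def Stmt.writes (a : ℕ) : Stmt → Bool
  | .store a' _ _ => a' == a
  | .seq c d => c.writes a || d.writes a
  | .loop _ c => c.writes a

section Run

variable {N : ℕ} {A : ℕ → ℕ → ℕ} {env : ℕ → ℕ}

/-- Induction over the rounds of a loop. -/
theorem Stmt.run_loop_induction {c : Stmt} {x : ℕ} {P : ℕ → (ℕ → ℕ → ℕ) → Prop} (h0 : P 0 A)
    (hs : ∀ i < N, ∀ A, P i A → P (i + 1) (c.run N (Function.update env x i) A)) :
    P N ((Stmt.loop x c).run N env A) := by
  have : ∀ m ≤ N, P m (Nat.rec A (fun i A' => c.run N (Function.update env x i) A') m) := by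
    intro m
    induction m with
    | zero => intro _; exact h0
    | succ m ih => intro hm; exact hs m (by omega) _ (ih (by omega))
  exact this N le_rfl

theorem Stmt.run_of_writes {a : ℕ} (c : Stmt) (h : c.writes a = false) :
    ∀ (env : ℕ → ℕ) (A : ℕ → ℕ → ℕ), c.run N env A a = A a := by
  induction c with
  | store a' i e =>
    intro env A
    have : a ≠ a' := by rintro rfl; simp [Stmt.writes] at h
    simp [Stmt.run, this]
  | seq c d ihc ihd =>
    intro env A
    simp only [Stmt.writes, Bool.or_eq_false_iff] at h
    rw [Stmt.run, ihd h.2, ihc h.1]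
  | loop x c ih =>
    intro env A
    exact Stmt.run_loop_induction (P := fun _ A' => A' a = A a) rfl
      (fun i _ A' hA' => by rw [ih h, hA'])

theorem Term.val_congr {A A' : ℕ → ℕ → ℕ} {a : ℕ} (h : ∀ a' ≠ a, A a' = A' a') (e : Term)
    (he : e.reads a = false) : ∀ env, e.val N A env = e.val N A' env := by
  induction e with
  | const k => intro env; rfl
  | var x => intro env; rfl
  | get a' i ih =>
    intro env
    simp only [Term.reads, Bool.or_eq_false_iff, beq_eq_false_iff_ne] at he
    rw [Term.val_get, Term.val_get, ih he.2, h a' he.1]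
  | op o e f ihe ihf =>
    intro env
    simp only [Term.reads, Bool.or_eq_false_iff] at he
    simp only [Term.val]
    rw [ihe he.1, ihf he.2]
  | agg g x e ih =>
    intro env
    simp only [Term.val, ih he]

/-- A loop that fills the array `a`. -/
theorem Stmt.run_loop_store {a x : ℕ} {e : Term} (he : e.reads a = false) (i : Fin N) :
    (Stmt.loop x (.store a (.var x) e)).run N env A a i =
      min (e.val N A (Function.update env x i)) (8 * N) := by
  have := Stmt.run_loop_induction (N := N) (A := A) (env := env) (x := x)
    (c := .store a (.var x) e)
    (P := fun m A' => (∀ a' ≠ a, A' a' = A a') ∧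
      ∀ i < m, A' a i = min (e.val N A (Function.update env x i)) (8 * N))
    ⟨fun _ _ => rfl, by simp⟩ (by
      intro m _ A' ⟨h1, h2⟩
      refine ⟨fun a' ha' => by simp [Stmt.run, ha', h1], fun i hi => ?_⟩
      simp only [Stmt.run, Function.update_self, Term.val_var]
      by_cases him : i = m
      · subst him
        rw [Function.update_self, Term.val_congr h1 e he]
      · rw [Function.update_of_ne him]
        exact h2 i (by omega))
  exact this.2 i i.2

end Run

theorem index_inj {n : ℕ} {i j i' j' : Fin n} (h : (i : ℕ) * n + j = i' * n + j') :
    i = i' ∧ j = j' := by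
  have hn : 0 < n := i.pos
  have h1 : ((i : ℕ) * n + j) / n = i := by
    rw [mul_comm, Nat.mul_add_div hn, Nat.div_eq_of_lt j.2, add_zero]
  have h2 : ((i' : ℕ) * n + j') / n = i' := by
    rw [mul_comm, Nat.mul_add_div hn, Nat.div_eq_of_lt j'.2, add_zero]
  have h3 : i = i' := Fin.ext (by rw [← h1, h, h2])
  subst h3
  exact ⟨rfl, Fin.ext (by omega)⟩

/-- A double loop that fills the matrix `a`. -/
theorem Stmt.run_loop_store_entry {N a x y : ℕ} {A : ℕ → ℕ → ℕ} {env : ℕ → ℕ} {e : Term}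
    (hxy : x ≠ y) (hx : x ≠ 0) (hy : y ≠ 0) (h0 : env 0 = N)
    (he : e.reads a = false) (i j : Fin N) :
    (Stmt.loop x (.loop y (.store a (.var x * .var 0 + .var y) e))).run N env A a (i * N + j) =
      min (e.val N A (Function.update (Function.update env x i) y j)) (8 * N) := by
  let good (A' : ℕ → ℕ → ℕ) (i j : Fin N) : Prop :=
    A' a (i * N + j) = min (e.val N A (Function.update (Function.update env x i) y j)) (8 * N)
  have := Stmt.run_loop_induction (N := N) (A := A) (env := env) (x := x)
    (c := .loop y (.store a (.var x * .var 0 + .var y) e))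
    (P := fun m A' => (∀ a' ≠ a, A' a' = A a') ∧ ∀ i j : Fin N, (i : ℕ) < m → good A' i j)
    ⟨fun _ _ => rfl, by simp⟩ (by
      intro m hm A' ⟨h1, h2⟩
      have := Stmt.run_loop_induction (N := N) (A := A') (env := Function.update env x m) (x := y)
        (c := .store a (.var x * .var 0 + .var y) e)
        (P := fun l A' => (∀ a' ≠ a, A' a' = A a') ∧
          ∀ i j : Fin N, ((i : ℕ) < m ∨ (i : ℕ) = m ∧ (j : ℕ) < l) → good A' i j)
        ⟨h1, fun i j hij => h2 i j (by omega)⟩ (by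
          intro l hl A' ⟨h1, h2⟩
          refine ⟨fun a' ha' => by simp [Stmt.run, ha', h1], fun i j hij => ?_⟩
          change Stmt.run _ _ _ _ _ _ = _
          simp only [Stmt.run, Function.update_self, Term.val_var, Term.val_add, Term.val_mul,
            Function.update_of_ne hxy, Function.update_of_ne hx.symm,
            Function.update_of_ne hy.symm, h0]
          by_cases hc : (i : ℕ) = m ∧ (j : ℕ) = l
          · rw [← hc.1, ← hc.2, Function.update_self, Term.val_congr h1 e he]
          · rw [Function.update_of_ne]
            · exact h2 i j (by omega)
            · intro heq
              have := index_inj (i' := ⟨m, hm⟩) (j' := ⟨l, hl⟩) heq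
              exact hc ⟨congrArg Fin.val this.1, congrArg Fin.val this.2⟩)
      exact ⟨this.1, fun i j hi => this.2 i j (by omega)⟩)
  exact this.2 i j i.2

end LoopLang

namespace LoopLang

open Finset WordRAM SimpleGraph

/-! ### The program -/

/-- The matrix of distances before any intermediate vertex is allowed; the length `n` stands for
infinity. -/
def initDist : Stmt :=
  .loop 2 (.loop 3 (.store 2 (.var 2 * .var 0 + .var 3)
    ((.const 1 - (Term.var 2).eq (.var 3)) *
      (.var 0 - .entry 0 (.var 2) (.var 3) * (.var 0 - .const 1)))))

/-- The algorithm of Floyd and Warshall. -/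
def floydWarshall : Stmt :=
  .loop 2 (.loop 3 (.loop 4 (.store 2 (.var 3 * .var 0 + .var 4)
    ((Term.entry 2 (.var 3) (.var 4)).min
      (.entry 2 (.var 3) (.var 2) + .entry 2 (.var 2) (.var 4))))))

/-- Array `3` marks the vertices of degree at least three. -/
def markBranches : Stmt :=
  .loop 2 (.store 3 (.var 2)
    ((Term.const 2).lt (.agg .sum 3 (.entry 0 (.var 2) (.var 3)))))

/-- The cell `0` of array `4` holds the maximal distance of two marked vertices; the cells `1` and `2`
are for the ends of the backbone. -/
def findDiam : Stmt :=
  .store 4 (.const 0) (.agg .sup 2 (.agg .sup 3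
    (.get 3 (.var 2) * .get 3 (.var 3) * .entry 2 (.var 2) (.var 3))))

/-- The first end of the backbone. If no vertex is marked, both ends are the vertex `0`: then the tree
is a path, and the backbone is a single vertex with at most two hairs. -/
def findLeft : Stmt :=
  .store 4 (.const 1) (.agg .sup 2 (.var 2 * .agg .sup 3
    (.get 3 (.var 2) * .get 3 (.var 3) *
      (Term.entry 2 (.var 2) (.var 3)).eq (.get 4 (.const 0)))))

/-- The second end of the backbone. -/
def findRight : Stmt :=
  .store 4 (.const 2) (.agg .sup 2 (.var 2 *
    (.get 3 (.var 2) *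
      (Term.entry 2 (.get 4 (.const 1)) (.var 2)).eq (.get 4 (.const 0)))))

/-- Array `5` holds the positions along the backbone. -/
def computePos : Stmt :=
  .loop 2 (.store 5 (.var 2) (Term.quot
    (.entry 2 (.get 4 (.const 1)) (.var 2) + .entry 2 (.get 4 (.const 1)) (.get 4 (.const 2)) -
      .entry 2 (.get 4 (.const 2)) (.var 2)) (.const 2)))

/-- Array `6` holds the heights above the backbone. -/
def computeHeight : Stmt :=
  .loop 2 (.store 6 (.var 2) (Term.quot
    (.entry 2 (.get 4 (.const 1)) (.var 2) + .entry 2 (.get 4 (.const 2)) (.var 2) -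
      .entry 2 (.get 4 (.const 1)) (.get 4 (.const 2))) (.const 2)))

/-- Array `7` holds the lengths of the hairs; see `HairedPath.hairLen`. -/
def computeLen : Stmt :=
  .loop 2 (.store 7 (.var 2) (.agg .sup 3
    (.get 6 (.var 3) *
      (Term.entry 2 (.var 2) (.var 3) + .get 6 (.var 2)).eq (.get 6 (.var 3)))))

/-- Array `8` holds the lengths of the hairs, in buckets. -/
def computeReach : Stmt :=
  .loop 2 (.store 8 (.var 2) (Term.quot (.get 7 (.var 2)) (.const 4 * .var 1)))

/-- Array `9` holds the heights, in buckets. -/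
def computeOffset : Stmt :=
  .loop 2 (.store 9 (.var 2) (Term.quot (.get 6 (.var 2)) (.const 4 * .var 1)))

/-- The value of `rightDepth` for the depths in array `10`. -/
def rightTerm (x : ℕ) : Term :=
  .agg .sup 4 (.get 10 (.var 4) *
    ((Term.get 5 (.var x) + .const 2 * .get 8 (.var 4)).lt (.get 5 (.var 4)) *
      (Term.get 5 (.var 4) + .const 2 * .get 8 (.var 4)).lt
        (.get 5 (.var x) + .const 2 * .get 8 (.var x) + .const 1)))

/-- The value of `leftDepth` for the depths in array `10`. -/
def leftTerm (x : ℕ) : Term :=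
  .agg .sup 4 (.get 10 (.var 4) *
    ((Term.get 5 (.var 4) + .const 2 * .get 8 (.var 4)).lt (.get 5 (.var x)) *
      (Term.get 5 (.var x) + .const 2 * .get 8 (.var 4)).lt
        (.get 5 (.var 4) + .const 2 * .get 8 (.var x) + .const 1)))

/-- Array `10` holds the depths; the round `k` settles those of the vertices with reach `k`. -/
def computeDepth : Stmt :=
  .loop 2 (.loop 3 (.store 10 (.var 3) (.const 1 + (rightTerm 3).min (leftTerm 3))))

/-- Array `11` holds the buckets; see `HairedPath.bucket`. -/
def computeBucket : Stmt :=
  .loop 2 (.store 11 (.var 2)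
    (.var 0 + .get 5 (.var 2) + (rightTerm 2).lt (leftTerm 2 + .const 1) * .get 9 (.var 2) -
      (leftTerm 2).lt (rightTerm 2) * .get 9 (.var 2)))

/-- Array `1` holds the layout; see `rankLayout`. -/
def computeLayout : Stmt :=
  .loop 2 (.store 1 (.var 2) (.const 1 + .agg .sum 3
    ((Term.get 11 (.var 3)).lt (.get 11 (.var 2)) +
      (Term.get 11 (.var 3)).eq (.get 11 (.var 2)) * (Term.var 3).lt (.var 2))))

/-- The term that is `1` if the layout in array `1` has bandwidth at most `48 * b ^ 3`. -/
def checkTerm : Term :=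
  (Term.const 0).eq (.agg .sum 2 (.agg .sum 3 (.entry 0 (.var 2) (.var 3) *
    (Term.const 48 * .var 1 * .var 1 * .var 1).lt
      ((.get 1 (.var 2) - .get 1 (.var 3)) + (.get 1 (.var 3) - .get 1 (.var 2))))))

/-! ### Correctness of the program -/

/-- Array `a` holds the vector `f`. -/
def IsVec {n : ℕ} (A : ℕ → ℕ → ℕ) (a : ℕ) (f : Fin n → ℕ) : Prop := ∀ w : Fin n, A a w = f w

/-- Array `a` holds the matrix `f`. -/
def IsMat {n : ℕ} (A : ℕ → ℕ → ℕ) (a : ℕ) (f : Fin n → Fin n → ℕ) : Prop :=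
  ∀ u v : Fin n, A a (u * n + v) = f u v

variable {n b : ℕ} {T : SimpleGraph (Fin n)} {A : ℕ → ℕ → ℕ} {env : ℕ → ℕ}

open Classical in
/-- The entries of the adjacency matrix. -/
noncomputable def adjEntry (T : SimpleGraph (Fin n)) (u v : Fin n) : ℕ := if T.Adj u v then 1 else 0

theorem dist_lt (hT : T.Connected) (u v : Fin n) : T.dist u v < n := by
  obtain ⟨p, hp, hp'⟩ := hT.exists_path_of_dist u v
  have := hp.length_lt
  rw [Fintype.card_fin] at this
  omega

theorem isMat_initDist (h0 : env 0 = n) (hA : IsMat A 0 (adjEntry T)) :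
    IsMat (initDist.run n env A) 2 (fun u v => if u = v then 0 else
      if adjEntry T u v = 1 then 1 else n) := by
  intro u v
  unfold initDist
  rw [Stmt.run_loop_store_entry (by decide) (by decide) (by decide) h0 rfl]
  simp only [Term.val_mul, Term.val_sub, Term.val_const, Term.val_eq, Term.val_var, Term.val_entry,
    Function.update_apply, h0]
  simp only [reduceIte, Nat.reduceEqDiff, hA u v, OfNat.zero_ne_ofNat,
    ← Fin.ext_iff]
  have := u.pos
  unfold adjEntry
  by_cases huv : u = v
  · simp [huv]
  · by_cases hadj : T.Adj u v
    · simp only [huv, hadj, if_true, if_false, Nat.sub_zero, one_mul]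
      omega
    · simp only [huv, hadj, if_false, Nat.sub_zero, one_mul, zero_mul, zero_ne_one]
      exact min_eq_left (by omega)

/-- The distances in array `2` are correct for paths from `i` to `j` with inner vertices
below `k`. -/
def DistDone (T : SimpleGraph (Fin n)) (A : ℕ → ℕ → ℕ) (k : ℕ) (i j : Fin n) : Prop :=
  ∀ p : T.Walk i j, p.IsPath → (∀ z ∈ p.support, z ≠ i → z ≠ j → (z : ℕ) < k) →
    A 2 (i * n + j) ≤ p.length

/-- The update in the round `k` allows paths through the vertex `k`. -/
theorem min_le_length {k : ℕ} (hA : ∀ i j, DistDone T A k i j) {i j : Fin n}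
    (p : T.Walk i j) (hp : p.IsPath)
    (hpk : ∀ z ∈ p.support, z ≠ i → z ≠ j → (z : ℕ) < k + 1) :
    min (A 2 (i * n + j)) (A 2 (i * n + k) + A 2 (k * n + j)) ≤ p.length := by
  by_cases h : ∀ z ∈ p.support, z ≠ i → z ≠ j → (z : ℕ) < k
  · exact (min_le_left _ _).trans (hA i j p hp h)
  push Not at h
  obtain ⟨z, hz, hzi, hzj, hzk⟩ := h
  have hzk' : (z : ℕ) = k := by have := hpk z hz hzi hzj; omega
  have hspec := p.take_spec hz
  have hdisj : ∀ y, y ∈ (p.takeUntil z hz).support → y ∈ (p.dropUntil z hz).support → y = z := by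
    intro y hy1 hy2
    have hnd := hp.support_nodup
    rw [← hspec, Walk.support_append, List.nodup_append] at hnd
    rw [Walk.mem_support_iff] at hy2
    rcases hy2 with rfl | hy2
    · rfl
    · exact absurd rfl (hnd.2.2 y hy1 y hy2)
  have h1 := hA i z (p.takeUntil z hz) (hp.takeUntil hz) (by
    intro y hy hyi hyz
    have hyj : y ≠ j := by
      rintro rfl
      exact hyz (hdisj y hy (Walk.end_mem_support _))
    have := hpk y (p.support_takeUntil_subset_support hz hy) hyi hyj
    have : (y : ℕ) ≠ z := fun h => hyz (Fin.ext h)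
    omega)
  have h2 := hA z j (p.dropUntil z hz) (hp.dropUntil hz) (by
    intro y hy hyz hyj
    have hyi : y ≠ i := by
      rintro rfl
      exact hyz (hdisj y (Walk.start_mem_support _) hy)
    have := hpk y (p.support_dropUntil_subset_support hz hy) hyi hyj
    have : (y : ℕ) ≠ z := fun h => hyz (Fin.ext h)
    omega)
  have h3 := congrArg Walk.length hspec
  rw [Walk.length_append] at h3
  rw [hzk'] at h1 h2
  omega

theorem isMat_floydWarshall (hT : T.Connected) (h0 : env 0 = n)
    (hA : IsMat A 2 (fun u v => if u = v then 0 else if adjEntry T u v = 1 then 1 else n)) :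
    IsMat (floydWarshall.run n env A) 2 T.dist := by
  let Low (A : ℕ → ℕ → ℕ) : Prop :=
    ∀ i j : Fin n, T.dist i j ≤ A 2 (i * n + j) ∧ A 2 (i * n + j) ≤ n
  have key := Stmt.run_loop_induction (N := n) (A := A) (env := env) (x := 2)
    (c := .loop 3 (.loop 4 (.store 2 (.var 3 * .var 0 + .var 4)
    ((Term.entry 2 (.var 3) (.var 4)).min
      (.entry 2 (.var 3) (.var 2) + .entry 2 (.var 2) (.var 4))))))
    (P := fun k A => Low A ∧ ∀ i j, DistDone T A k i j) ⟨?_, ?_⟩ ?_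
  · intro i j
    apply le_antisymm _ (key.1 i j).1
    obtain ⟨p, hp, hp'⟩ := hT.exists_path_of_dist i j
    rw [← hp']
    exact key.2 i j p hp (fun z _ _ _ => z.2)
  · intro i j
    rw [hA i j]
    have hlt := dist_lt hT i j
    by_cases hij : i = j
    · subst hij; simp
    · unfold adjEntry
      by_cases hadj : T.Adj i j
      · simp [hij, hadj, dist_eq_one_iff_adj.mpr hadj]; omega
      · simp [hij, hadj]; omega
  · intro i j p hp hpk
    rw [hA i j]
    cases p with
    | nil => simp
    | cons hadj q =>
      rename_i w
      by_cases hij : i = j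
      · simp [hij]
      · by_cases hwj : w = j
        · subst hwj
          simp [hij, adjEntry, hadj]
        · have := hpk w (by simp) hadj.ne' hwj
          omega
  · intro k hk A1 hA1
    have key2 := Stmt.run_loop_induction (N := n) (A := A1) (env := Function.update env 2 k)
      (x := 3)
      (c := .loop 4 (.store 2 (.var 3 * .var 0 + .var 4)
      ((Term.entry 2 (.var 3) (.var 4)).min
        (.entry 2 (.var 3) (.var 2) + .entry 2 (.var 2) (.var 4)))))
      (P := fun m A => (Low A ∧ ∀ i j, DistDone T A k i j) ∧
        ∀ i j : Fin n, (i : ℕ) < m → DistDone T A (k + 1) i j) ⟨hA1, by simp⟩ ?_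
    · exact ⟨key2.1.1, fun i j => key2.2 i j i.2⟩
    intro m hm A2 hA2
    have key3 := Stmt.run_loop_induction (N := n) (A := A2)
      (env := Function.update (Function.update env 2 k) 3 m) (x := 4)
      (c := .store 2 (.var 3 * .var 0 + .var 4)
      ((Term.entry 2 (.var 3) (.var 4)).min
        (.entry 2 (.var 3) (.var 2) + .entry 2 (.var 2) (.var 4))))
      (P := fun l A => (Low A ∧ ∀ i j, DistDone T A k i j) ∧
        ∀ i j : Fin n, ((i : ℕ) < m ∨ (i : ℕ) = m ∧ (j : ℕ) < l) → DistDone T A (k + 1) i j)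
      ⟨hA2.1, fun i j hij => hA2.2 i j (by omega)⟩ ?_
    · exact ⟨key3.1, fun i j hi => key3.2 i j (by omega)⟩
    intro l hl A3 ⟨⟨hlow, hdone⟩, hdone'⟩
    -- The only cell that changes is the one for `(m, l)`.
    have hcell : ∀ i j : Fin n,
        Stmt.run n (.store 2 (.var 3 * .var 0 + .var 4)
          ((Term.entry 2 (.var 3) (.var 4)).min
            (.entry 2 (.var 3) (.var 2) + .entry 2 (.var 2) (.var 4))))
          (Function.update (Function.update (Function.update env 2 k) 3 m) 4 l) A3 2 (i * n + j) =
        if (i : ℕ) = m ∧ (j : ℕ) = l then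
          min (A3 2 (i * n + j)) (A3 2 (i * n + k) + A3 2 (k * n + j))
        else A3 2 (i * n + j) := by
      intro i j
      simp only [Stmt.run, Function.update_self, Term.val_min, Term.val_entry, Term.val_var,
        Term.val_add, Term.val_mul, Function.update_apply, h0]
      simp only [reduceIte, Nat.reduceEqDiff, OfNat.zero_ne_ofNat]
      by_cases hc : (i : ℕ) = m ∧ (j : ℕ) = l
      · obtain ⟨rfl, rfl⟩ := hc
        have := (hlow i j).2
        simp
        omega
      · rw [if_neg, if_neg hc]
        intro heq
        have := index_inj (i' := ⟨m, hm⟩) (j' := ⟨l, hl⟩) heq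
        exact hc ⟨congrArg Fin.val this.1, congrArg Fin.val this.2⟩
    refine ⟨⟨fun i j => ?_, fun i j p hp hpk => ?_⟩, fun i j hij p hp hpk => ?_⟩
    · rw [hcell]
      have h1 := hlow i j
      split_ifs
      · have h2 := hlow i ⟨k, hk⟩
        have h3 := hlow ⟨k, hk⟩ j
        have h4 := hT.dist_triangle (u := i) (v := ⟨k, hk⟩) (w := j)
        simp only at h2 h3
        omega
      · exact h1
    · rw [hcell]
      have := hdone i j p hp hpk
      split_ifs <;> omega
    · rw [hcell]
      split_ifs with hc
      · exact min_le_length hdone p hp hpk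
      · exact hdone' i j (by omega) p hp hpk

end LoopLang

namespace LoopLang

open Finset WordRAM SimpleGraph

variable {n b : ℕ} {T : SimpleGraph (Fin n)} {A : ℕ → ℕ → ℕ} {env : ℕ → ℕ}

theorem isVec_markBranches [DecidableRel T.Adj] (h0 : env 0 = n) (hA : IsMat A 0 (adjEntry T)) :
    IsVec (markBranches.run n env A) 3 (fun w => if 3 ≤ T.degree w then 1 else 0) := by
  intro w
  unfold markBranches
  rw [Stmt.run_loop_store rfl]
  simp only [Term.val_lt, Term.val_const, Term.val_sum, Term.val_entry, Term.val_var,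
    Function.update_apply, h0]
  simp only [reduceIte, Nat.reduceEqDiff, OfNat.zero_ne_ofNat, hA w _]
  have : ∑ v, adjEntry T w v = T.degree w := by
    rw [← card_neighborFinset_eq_degree, neighborFinset_eq_filter, card_filter]
    unfold adjEntry
    congr!
  rw [this]
  have := w.pos
  split_ifs <;> omega

/-- The maximum of the indices with a property has the property, if any index has it. -/
theorem exists_eq_sup_mul_ite {P : Fin n → Prop} [DecidablePred P] (hn : 0 < n) :
    ∃ x : Fin n, (univ.sup fun i : Fin n => (i : ℕ) * if P i then 1 else 0) = x ∧
      ((∃ i, P i) → P x) := by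
  obtain ⟨i, -, hi⟩ := exists_mem_eq_sup univ ⟨⟨0, hn⟩, mem_univ _⟩
    (fun i : Fin n => (i : ℕ) * if P i then 1 else 0)
  by_cases hP : P i
  · exact ⟨i, by rw [hi, if_pos hP, mul_one], fun _ => hP⟩
  · rw [if_neg hP, mul_zero] at hi
    refine ⟨⟨0, hn⟩, hi, fun ⟨j, hj⟩ => ?_⟩
    have := le_sup (f := fun i : Fin n => (i : ℕ) * if P i then 1 else 0) (mem_univ j)
    rw [hi] at this
    simp only [hj, if_true, mul_one, Nat.le_zero] at this
    have hj0 : j = ⟨0, hn⟩ := Fin.ext this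
    exact hj0 ▸ hj

theorem sup_ite_one {P : Fin n → Prop} [DecidablePred P] [Decidable (∃ i, P i)] :
    (univ.sup fun i : Fin n => if P i then 1 else 0) = if ∃ i, P i then 1 else 0 := by
  by_cases h : ∃ i, P i
  · rw [if_pos h]
    obtain ⟨i, hi⟩ := h
    apply le_antisymm
    · exact Finset.sup_le fun j _ => by split_ifs <;> omega
    · have := le_sup (f := fun i : Fin n => if P i then 1 else 0) (mem_univ i)
      simpa [hi] using this
  · push Not at h
    simp [h]

theorem ite_mul_ite_one {P Q : Prop} [Decidable P] [Decidable Q] :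
    ((if P then 1 else 0) * (if Q then 1 else 0) : ℕ) = if P ∧ Q then 1 else 0 := by
  split_ifs <;> simp_all

/-- The two ends of the backbone are farthest apart among the marked vertices. -/
theorem exists_ends {P : Fin n → Prop} [DecidablePred P] (hT : T.Connected) (hn : 0 < n) (h0 : env 0 = n)
    (h2 : IsMat A 2 T.dist) (h3 : IsVec A 3 (fun w => if P w then 1 else 0)) :
    ∃ x y : Fin n, (findRight.run n env (findLeft.run n env (findDiam.run n env A))) 4 1 = x ∧
      (findRight.run n env (findLeft.run n env (findDiam.run n env A))) 4 2 = y ∧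
      ((∃ w, P w) → P x ∧ P y ∧ ∀ u v, P u → P v → T.dist u v ≤ T.dist x y) := by
  set A1 := findDiam.run n env A with hA1
  set A2 := findLeft.run n env A1 with hA2
  set A3 := findRight.run n env A2 with hA3
  set D := univ.sup fun u => univ.sup fun v =>
    (if P u then 1 else 0) * (if P v then 1 else 0) * T.dist u v with hD
  have hDn : D ≤ n := by
    refine Finset.sup_le fun u _ => Finset.sup_le fun v _ => ?_
    have := dist_lt hT u v
    split_ifs <;> simp
    omega
  have hd : A1 4 0 = D := by
    rw [hA1, findDiam]
    simp only [Stmt.run, Function.update_self, Term.val_const, Term.val_sup, Term.val_mul,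
      Term.val_get, Term.val_var, Term.val_entry, Function.update_apply, h0]
    simp only [reduceIte, Nat.reduceEqDiff, OfNat.zero_ne_ofNat,
      h2 _ _, h3 _]
    rw [← hD]
    omega
  have h21 : IsMat A1 2 T.dist := fun u v => by
    rw [hA1, Stmt.run_of_writes findDiam rfl]; exact h2 u v
  have h31 : IsVec A1 3 (fun w => if P w then 1 else 0) := fun u => by
    rw [hA1, Stmt.run_of_writes findDiam rfl]; exact h3 u
  obtain ⟨x, hx, hPx⟩ := exists_eq_sup_mul_ite (n := n)
    (P := fun u => ∃ v, (P u ∧ P v) ∧ T.dist u v = D) hn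
  have hx1 : A2 4 1 = x := by
    rw [hA2, findLeft]
    simp only [Stmt.run, Function.update_self, Term.val_const, Term.val_sup, Term.val_mul,
      Term.val_get, Term.val_var, Term.val_entry, Term.val_eq, Function.update_apply, h0]
    simp only [reduceIte, Nat.reduceEqDiff, OfNat.zero_ne_ofNat,
      h21 _ _, h31 _, hd, ite_mul_ite_one, sup_ite_one]
    refine (congrArg (min · (8 * n)) ?_).trans (min_eq_left (by have := x.2; omega))
    convert hx
  have h22 : IsMat A2 2 T.dist := fun u v => by
    rw [hA2, Stmt.run_of_writes findLeft rfl]; exact h21 u v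
  have h32 : IsVec A2 3 (fun w => if P w then 1 else 0) := fun u => by
    rw [hA2, Stmt.run_of_writes findLeft rfl]; exact h31 u
  have hd2 : A2 4 0 = D := by
    rw [← hd, hA2, findLeft]
    simp [Stmt.run, Term.val_const]
  obtain ⟨y, hy, hPy⟩ := exists_eq_sup_mul_ite (n := n)
    (P := fun v => P v ∧ T.dist x v = D) hn
  have hy1 : A3 4 2 = y := by
    rw [hA3, findRight]
    simp only [Stmt.run, Function.update_self, Term.val_const, Term.val_sup, Term.val_mul,
      Term.val_get, Term.val_var, Term.val_entry, Term.val_eq, Function.update_apply, h0]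
    simp only [reduceIte, OfNat.zero_ne_ofNat,
      h32 _, hd2, hx1, h22 x _, ite_mul_ite_one, hy]
    have := y.2
    omega
  have hx2 : A3 4 1 = x := by
    rw [← hx1, hA3, findRight]
    simp [Stmt.run, Term.val_const]
  refine ⟨x, y, hx2, hy1, fun ⟨w, hw⟩ => ?_⟩
  have hle : ∀ u v, P u → P v → T.dist u v ≤ D := by
    intro u v hu hv
    have h4 := le_sup (f := fun v => (if P u then 1 else 0) * (if P v then 1 else 0) * T.dist u v)
      (mem_univ v)
    have h5 := le_sup (f := fun u => univ.sup fun v =>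
      (if P u then 1 else 0) * (if P v then 1 else 0) * T.dist u v) (mem_univ u)
    simp only [hu, hv, if_true, one_mul] at h4
    refine h4.trans (le_trans ?_ h5)
    simp [hu]
  have hattained : ∃ u v, (P u ∧ P v) ∧ T.dist u v = D := by
    by_cases hD0 : D = 0
    · exact ⟨w, w, ⟨hw, hw⟩, by simp [hD0]⟩
    · obtain ⟨u, -, hu⟩ := exists_mem_eq_sup univ ⟨w, mem_univ _⟩ (fun u => univ.sup fun v =>
        (if P u then 1 else 0) * (if P v then 1 else 0) * T.dist u v)
      obtain ⟨v, -, hv⟩ := exists_mem_eq_sup univ ⟨w, mem_univ _⟩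
        (fun v => (if P u then 1 else 0) * (if P v then 1 else 0) * T.dist u v)
      rw [← hD, hv] at hu
      by_cases hPu : P u
      · by_cases hPv : P v
        · exact ⟨u, v, ⟨hPu, hPv⟩, by rw [hu]; simp [hPu, hPv]⟩
        · simp [hPv] at hu; omega
      · simp [hPu] at hu; omega
  obtain ⟨v, ⟨hPx', hPv⟩, hxv⟩ := hPx hattained
  obtain ⟨hPy', hxy⟩ := hPy ⟨v, hPv, hxv⟩
  exact ⟨hPx', hPy', fun u v hu hv => hxy ▸ hle u v hu hv⟩

theorem Term.val_quot {N : ℕ} {e m : Term}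
    (he : ∀ i, e.val N A (Function.update env 5 i) = e.val N A env)
    (hm : ∀ i, m.val N A (Function.update env 5 i) = m.val N A env) (hm0 : 0 < m.val N A env)
    (hle : e.val N A env / m.val N A env ≤ N) :
    (Term.quot e m).val N A env = e.val N A env / m.val N A env := by
  rw [Term.quot, Term.val_sum]
  simp only [Term.val_lt, Term.val_mul, Term.val_add, Term.val_var, Term.val_const,
    Function.update_self, he, hm]
  exact sum_ite_mul_succ_le hm0 hle

section Stages

variable {x y : Fin n}

theorem projPos_lt (hT : T.IsTree) (w : Fin n) : T.projPos x y w < n := by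
  have h1 := hT.dist_eq_proj x y w
  have h2 := dist_lt hT.connected x w
  omega

theorem projHeight_lt (hT : T.IsTree) (w : Fin n) : T.projHeight x y w < n := by
  have h1 := hT.dist_eq_proj x y w
  have h2 := dist_lt hT.connected x w
  omega

theorem isVec_computePos (hT : T.IsTree) (h0 : env 0 = n) (h2 : IsMat A 2 T.dist)
    (hx : A 4 1 = x) (hy : A 4 2 = y) :
    IsVec (computePos.run n env A) 5 (T.projPos x y) := by
  intro w
  unfold computePos
  have h1 := projPos_lt (x := x) (y := y) hT w
  have h3 : T.projPos x y w = (T.dist x w + T.dist x y - T.dist y w) / 2 := rfl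
  have hval : ∀ e : Term, e = Term.entry 2 (.get 4 (.const 1)) (.var 2) +
      .entry 2 (.get 4 (.const 1)) (.get 4 (.const 2)) - .entry 2 (.get 4 (.const 2)) (.var 2) →
      e.val n A (Function.update env 2 w) = T.dist x w + T.dist x y - T.dist y w := by
    rintro _ rfl
    simp only [Term.val_sub, Term.val_add, Term.val_entry, Term.val_get, Term.val_const,
      Term.val_var, Function.update_apply, h0, hx, hy]
    simp only [reduceIte, OfNat.zero_ne_ofNat, h2 _ _]
  rw [Stmt.run_loop_store rfl, Term.val_quot (fun _ => rfl) (fun _ => rfl)] <;>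
    simp only [hval _ rfl, Term.val_const] <;> omega

theorem isVec_computeHeight (hT : T.IsTree) (h0 : env 0 = n) (h2 : IsMat A 2 T.dist)
    (hx : A 4 1 = x) (hy : A 4 2 = y) :
    IsVec (computeHeight.run n env A) 6 (T.projHeight x y) := by
  intro w
  unfold computeHeight
  have h1 := projHeight_lt (x := x) (y := y) hT w
  have h3 : T.projHeight x y w = (T.dist x w + T.dist y w - T.dist x y) / 2 := rfl
  have hval : ∀ e : Term, e = Term.entry 2 (.get 4 (.const 1)) (.var 2) +
      .entry 2 (.get 4 (.const 2)) (.var 2) - .entry 2 (.get 4 (.const 1)) (.get 4 (.const 2)) →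
      e.val n A (Function.update env 2 w) = T.dist x w + T.dist y w - T.dist x y := by
    rintro _ rfl
    simp only [Term.val_sub, Term.val_add, Term.val_entry, Term.val_get, Term.val_const,
      Term.val_var, Function.update_apply, h0, hx, hy]
    simp only [reduceIte, OfNat.zero_ne_ofNat, h2 _ _]
  rw [Stmt.run_loop_store rfl, Term.val_quot (fun _ => rfl) (fun _ => rfl)] <;>
    simp only [hval _ rfl, Term.val_const] <;> omega

theorem isVec_computeLen (H : T.HairedPath) (hH : ∀ w, H.height w < n) (h0 : env 0 = n)
    (h2 : IsMat A 2 T.dist) (h6 : IsVec A 6 H.height) :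
    IsVec (computeLen.run n env A) 7 H.hairLen := by
  intro w
  unfold computeLen
  rw [Stmt.run_loop_store rfl]
  simp only [Term.val_sup, Term.val_mul, Term.val_get, Term.val_eq, Term.val_add, Term.val_entry,
    Term.val_var, Function.update_apply, h0]
  simp only [reduceIte, Nat.reduceEqDiff, OfNat.zero_ne_ofNat, h2 _ _,
    h6 _, mul_ite, mul_one, mul_zero]
  change min (H.hairLen w) _ = _
  obtain ⟨v, -, hv⟩ := H.exists_top w
  have := hH v
  omega

theorem isVec_computeQuot {a a' : ℕ} {f : Fin n → ℕ} (ha : a ≠ a') (hf : ∀ w, f w < n)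
    (h1 : env 1 = b) (hb : 0 < b) (hA : IsVec A a f) :
    IsVec ((Stmt.loop 2 (.store a' (.var 2)
      (Term.quot (.get a (.var 2)) (.const 4 * .var 1)))).run n env A) a'
      (fun w => f w / (4 * b)) := by
  intro w
  have h2 : f w / (4 * b) ≤ f w := Nat.div_le_self _ _
  have h3 := hf w
  have he : (Term.get a (.var 2)).val n A (Function.update env 2 w) = f w := by
    simp [Term.val_get, Term.val_var, hA w]
  have hm : (Term.const 4 * Term.var 1).val n A (Function.update env 2 w) = 4 * b := by
    simp [Term.val_mul, Term.val_const, Term.val_var, h1]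
  rw [Stmt.run_loop_store (by simp [Term.reads, Term.quot, Term.lt, HMul.hMul, Mul.mul, HAdd.hAdd,
    Add.add, ha]), Term.val_quot (fun _ => rfl) (fun _ => rfl), he, hm]
  · exact min_eq_left (by omega)
  · rw [hm]; omega
  · rw [he, hm]; omega

end Stages

end LoopLang

namespace SimpleGraph

open Finset

/-! ### The recursion for the depths -/

variable {V : Type*} [Fintype V] (pos reach : V → ℕ)

/-- The depths, by `k` rounds of their recursion. -/
def combDepth : ℕ → V → ℕ
  | 0, _ => 0
  | k + 1, w => 1 + min (rightDepth pos reach (combDepth k) w) (leftDepth pos reach (combDepth k) w)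

variable {pos reach}

/-- Only vertices of smaller reach enter into the recursion for the depth. -/
theorem depthFns_congr_depth {d d' : V → ℕ} {w : V} (h : ∀ v, reach v < reach w → d v = d' v) :
    rightDepth pos reach d w = rightDepth pos reach d' w ∧
      leftDepth pos reach d w = leftDepth pos reach d' w := by
  constructor
  · refine Finset.sup_congr rfl fun v _ => ?_
    split_ifs with hc
    · exact h v (by omega)
    · rfl
  · refine Finset.sup_congr rfl fun v _ => ?_
    split_ifs with hc
    · exact h v (by omega)
    · rfl

theorem combDepth_succ_eq : ∀ (k : ℕ) {w : V}, reach w < k →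
    combDepth pos reach (k + 1) w = combDepth pos reach k w := by
  intro k
  induction k with
  | zero => intro w h; omega
  | succ k ih =>
    intro w h
    obtain ⟨h1, h2⟩ := depthFns_congr_depth (pos := pos) (d := combDepth pos reach (k + 1))
      (reach := reach) (d' := combDepth pos reach k) (w := w) (fun v hv => ih (by omega))
    rw [combDepth, h1, h2, combDepth]

theorem combDepth_le : ∀ (k : ℕ) (w : V), combDepth pos reach k w ≤ k := by
  intro k
  induction k with
  | zero => intro w; exact le_rfl
  | succ k ih =>
    intro w
    have : rightDepth pos reach (combDepth pos reach k) w ≤ k :=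
      Finset.sup_le fun v _ => by
        have := ih v
        split_ifs <;> omega
    rw [combDepth]
    omega

end SimpleGraph

namespace LoopLang

open Finset WordRAM SimpleGraph

variable {n b : ℕ} {T : SimpleGraph (Fin n)} {A : ℕ → ℕ → ℕ} {env : ℕ → ℕ}

theorem val_rightTerm {pos reach : Fin n → ℕ} {x : ℕ} {w : Fin n} (hx : x ≠ 4) (hw : env x = w)
    (h5 : IsVec A 5 pos) (h8 : IsVec A 8 reach) :
    (rightTerm x).val n A env = rightDepth pos reach (fun v => A 10 v) w := by
  unfold rightTerm rightDepth
  simp only [Term.val_sup, Term.val_mul, Term.val_get, Term.val_lt, Term.val_add, Term.val_const,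
    Term.val_var, Function.update_self, Function.update_of_ne hx, hw, h5 _, h8 _,
    ite_mul_ite_one, Nat.lt_succ_iff]
  simp only [mul_ite, mul_one, mul_zero]

theorem val_leftTerm {pos reach : Fin n → ℕ} {x : ℕ} {w : Fin n} (hx : x ≠ 4) (hw : env x = w)
    (h5 : IsVec A 5 pos) (h8 : IsVec A 8 reach) :
    (leftTerm x).val n A env = leftDepth pos reach (fun v => A 10 v) w := by
  unfold leftTerm leftDepth
  simp only [Term.val_sup, Term.val_mul, Term.val_get, Term.val_lt, Term.val_add, Term.val_const,
    Term.val_var, Function.update_self, Function.update_of_ne hx, hw, h5 _, h8 _,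
    ite_mul_ite_one, Nat.lt_succ_iff]
  simp only [mul_ite, mul_one, mul_zero]

theorem isVec_computeDepth {pos reach : Fin n → ℕ} (hr : ∀ w, reach w < n)
    (h5 : IsVec A 5 pos) (h8 : IsVec A 8 reach) :
    IsVec (computeDepth.run n env A) 10 (combDepth pos reach n) := by
  have hfix : ∀ w, 1 + min (rightDepth pos reach (combDepth pos reach n) w)
      (leftDepth pos reach (combDepth pos reach n) w) = combDepth pos reach n w :=
    fun w => combDepth_succ_eq n (hr w)
  have key := Stmt.run_loop_induction (N := n) (A := A) (env := env) (x := 2)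
    (c := .loop 3 (.store 10 (.var 3) (.const 1 + (rightTerm 3).min (leftTerm 3))))
    (P := fun k A => (IsVec A 5 pos ∧ IsVec A 8 reach) ∧
      ∀ w : Fin n, reach w < k → A 10 w = combDepth pos reach n w) ⟨⟨h5, h8⟩, by simp⟩ ?_
  · exact fun w => key.2 w (hr w)
  intro k hk A1 hA1
  have key2 := Stmt.run_loop_induction (N := n) (A := A1) (env := Function.update env 2 k) (x := 3)
    (c := .store 10 (.var 3) (.const 1 + (rightTerm 3).min (leftTerm 3)))
    (P := fun m A => (IsVec A 5 pos ∧ IsVec A 8 reach) ∧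
      ∀ w : Fin n, (reach w < k ∨ reach w = k ∧ (w : ℕ) < m) →
        A 10 w = combDepth pos reach n w)
    ⟨hA1.1, fun w hw => hA1.2 w (by omega)⟩ ?_
  · exact ⟨key2.1, fun w hw => key2.2 w (by have := w.2; omega)⟩
  intro m hm A2 ⟨⟨h5, h8⟩, hd⟩
  refine ⟨⟨fun w => ?_, fun w => ?_⟩, fun w hw => ?_⟩
  · rw [Stmt.run_of_writes _ rfl]; exact h5 w
  · rw [Stmt.run_of_writes _ rfl]; exact h8 w
  · simp only [Stmt.run, Function.update_self, Term.val_var, Term.val_add, Term.val_const,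
      Term.val_min]
    by_cases hwm : (w : ℕ) = m
    · subst hwm
      rw [Function.update_self, val_rightTerm (w := w) (by decide) (by simp) h5 h8,
        val_leftTerm (w := w) (by decide) (by simp) h5 h8]
      obtain ⟨h1, h2⟩ := depthFns_congr_depth (pos := pos) (reach := reach) (w := w)
        (d := fun v : Fin n => A2 10 v) (d' := combDepth pos reach n)
        (fun v hv => hd v (by omega))
      rw [h1, h2, hfix]
      have := combDepth_le (pos := pos) (reach := reach) n w
      omega
    · rw [Function.update_of_ne hwm]
      exact hd w (by omega)

theorem isVec_computeBucket {pos height reach depth : Fin n → ℕ} (hp : ∀ w, pos w < n)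
    (hh : ∀ w, height w < n) (h0 : env 0 = n) (h5 : IsVec A 5 pos) (h8 : IsVec A 8 reach)
    (h9 : IsVec A 9 (fun w => height w / (4 * b))) (h10 : IsVec A 10 depth) :
    IsVec (computeBucket.run n env A) 11 (HairedPath.bucket n b pos height reach depth) := by
  intro w
  unfold computeBucket
  have h1 := hp w
  have h2 := (Nat.div_le_self (height w) (4 * b)).trans (hh w).le
  rw [Stmt.run_loop_store rfl]
  simp only [Term.val_sub, Term.val_add, Term.val_mul, Term.val_lt, Term.val_var, Term.val_get,
    Term.val_const, val_rightTerm (show 2 ≠ 4 by decide) (Function.update_self _ _ _) h5 h8,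
    val_leftTerm (show 2 ≠ 4 by decide) (Function.update_self _ _ _) h5 h8]
  simp only [Function.update_self, Function.update_of_ne (show 0 ≠ 2 by decide), h0, h5 w, h9 w,
    (funext h10 : (fun v : Fin n => A 10 v) = depth), Nat.lt_succ_iff]
  unfold HairedPath.bucket
  by_cases hc : rightDepth pos reach depth w ≤ leftDepth pos reach depth w
  · rw [if_pos hc, if_neg (by omega), if_pos hc, one_mul, zero_mul]
    exact min_eq_left (by omega)
  · rw [if_neg hc, if_pos (by omega), if_neg hc, one_mul, zero_mul, add_zero]
    exact min_eq_left ((Nat.sub_le _ _).trans (by omega))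

theorem isVec_computeLayout {key : Fin n → ℕ} (hA : IsVec A 11 key) :
    IsVec (computeLayout.run n env A) 1 (rankLayout key) := by
  intro w
  unfold computeLayout
  rw [Stmt.run_loop_store rfl]
  simp only [Term.val_add, Term.val_const, Term.val_sum, Term.val_lt, Term.val_eq, Term.val_mul,
    Term.val_get, Term.val_var, Function.update_self,
    Function.update_of_ne (show 2 ≠ 3 by decide), hA _]
  have : ∀ v : Fin n, ((if key v < key w then 1 else 0) +
      (if key v = key w then 1 else 0) * (if (v : ℕ) < w then 1 else 0) : ℕ) =
      if key v < key w ∨ key v = key w ∧ v < w then 1 else 0 := by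
    intro v
    rw [ite_mul_ite_one]
    split_ifs <;> simp_all; omega
  simp only [this, ← card_filter]
  have h1 := (isLayout_rankLayout key).1 (Set.mem_univ w)
  rw [Set.mem_Icc, Fintype.card_fin] at h1
  have h2 := h1.2
  change min (rankLayout key w) _ = _
  omega

theorem val_checkTerm {α : Fin n → ℕ} (h0 : env 0 = n) (h1 : env 1 = b)
    (hA0 : IsMat A 0 (adjEntry T)) (hA1 : IsVec A 1 α) :
    checkTerm.val n A env = if layoutBandwidth T α ≤ 48 * b ^ 3 then 1 else 0 := by
  unfold checkTerm
  simp only [Term.val_eq, Term.val_const, Term.val_sum, Term.val_mul, Term.val_entry, Term.val_lt,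
    Term.val_add, Term.val_sub, Term.val_get, Term.val_var, Function.update_self,
    Function.update_of_ne (show 2 ≠ 3 by decide), Function.update_of_ne (show 0 ≠ 3 by decide),
    Function.update_of_ne (show 0 ≠ 2 by decide), Function.update_of_ne (show 1 ≠ 3 by decide),
    Function.update_of_ne (show 1 ≠ 2 by decide), h0, h1, hA0 _ _, hA1 _]
  congr 1
  rw [layoutBandwidth_le_iff, eq_comm (a := 0), Finset.sum_eq_zero_iff, eq_comm, eq_iff_iff]
  refine forall_congr' fun u => ?_
  rw [Finset.sum_eq_zero_iff]
  simp only [mem_univ, forall_const]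
  refine forall_congr' fun v => ?_
  have h48 : 48 * b * b * b = 48 * b ^ 3 := by ring
  rw [h48]
  unfold adjEntry
  by_cases h : T.Adj u v
  · simp only [h, if_true, one_mul, true_imp_iff]
    split_ifs with hc
    · exact iff_of_false (by omega) not_false
    · exact iff_of_true (by omega) rfl
  · simp [h]

/-! ### The whole program -/

theorem IsVec.run {a : ℕ} {f : Fin n → ℕ} (h : IsVec A a f) {c : Stmt} (hc : c.writes a = false) :
    IsVec (c.run n env A) a f := fun w => by rw [Stmt.run_of_writes c hc]; exact h w

theorem IsMat.run {a : ℕ} {f : Fin n → Fin n → ℕ} (h : IsMat A a f) {c : Stmt}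
    (hc : c.writes a = false) : IsMat (c.run n env A) a f :=
  fun u v => by rw [Stmt.run_of_writes c hc]; exact h u v

/-- The distances and the backbone. -/
def analyzeTree : Stmt :=
  .seq initDist (.seq floydWarshall (.seq markBranches (.seq findDiam (.seq findLeft findRight))))

/-- The hairs and their depths. -/
def analyzeHairs : Stmt :=
  .seq computePos (.seq computeHeight (.seq computeLen (.seq computeReach
    (.seq computeOffset computeDepth))))

/-- The layout of the input tree. -/
def layoutStmt : Stmt :=
  .seq analyzeTree (.seq analyzeHairs (.seq computeBucket computeLayout))

theorem exists_hairedPath_analyzeTree (hT : IsCaterpillar T) (h0 : env 0 = n)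
    (hA : IsMat A 0 (adjEntry T)) :
    ∃ (x y : Fin n) (H : T.HairedPath), H.pos = T.projPos x y ∧ H.height = T.projHeight x y ∧
      IsMat (analyzeTree.run n env A) 2 T.dist ∧ analyzeTree.run n env A 4 1 = x ∧
      analyzeTree.run n env A 4 2 = y := by
  classical
  obtain ⟨hT, u, v, B, hB, hdeg⟩ := hT
  have h2 := isMat_floydWarshall hT.connected h0 (isMat_initDist (T := T) h0 hA)
  have h3 := isVec_markBranches h0 ((hA.run (env := env) (c := initDist) rfl).run (env := env)
    (c := floydWarshall) rfl)
  have h2' := h2.run (env := env) (c := markBranches) rfl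
  obtain ⟨x, y, hx, hy, hxy⟩ := exists_ends (P := fun w => 3 ≤ T.degree w) hT.connected u.pos h0 h2'
    h3
  have hdeg' : ∀ w, 3 ≤ T.degree w → T.dist x w + T.dist w y = T.dist x y := by
    intro w hw
    obtain ⟨hx3, hy3, hle⟩ := hxy ⟨w, hw⟩
    exact hT.dist_add_dist_of_farthest hB (hdeg x (by convert hx3)) (hdeg y (by convert hy3))
      (hdeg w (by convert hw)) (hle x w hx3 hw) (hle w y hw hy3)
  exact ⟨x, y, hT.hairedPath x y hdeg', rfl, rfl,
    ((h2'.run (c := findDiam) rfl).run (c := findLeft) rfl).run (c := findRight) rfl, hx, hy⟩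

/-- The program computes a layout, and its bandwidth is at most `48 * b ^ 3` if the tree has
bandwidth at most `b`. -/
theorem exists_layout_layoutStmt (hT : IsCaterpillar T) (hb : 0 < b) (h0 : env 0 = n)
    (h1 : env 1 = b) (hA : IsMat A 0 (adjEntry T)) :
    ∃ α : Fin n → ℕ, IsVec (layoutStmt.run n env A) 1 α ∧ IsLayout α ∧
      (bandwidth T ≤ b → layoutBandwidth T α ≤ 48 * b ^ 3) := by
  obtain ⟨x, y, H, hpos, hheight, h2, hx, hy⟩ := exists_hairedPath_analyzeTree hT h0 hA
  have hT := hT.1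
  have hp : ∀ w, H.pos w < n := fun w => by rw [hpos]; exact projPos_lt hT w
  have hh : ∀ w, H.height w < n := fun w => by rw [hheight]; exact projHeight_lt hT w
  have hlen : ∀ w, H.hairLen w < n := fun w => by
    obtain ⟨v, -, hv⟩ := H.exists_top w
    rw [← hv]; exact hh v
  set reach : Fin n → ℕ := fun w => H.hairLen w / (4 * b) with hreach
  have hr : ∀ w, reach w < n := fun w => (Nat.div_le_self _ _).trans_lt (hlen w)
  set A0 := analyzeTree.run n env A
  set A1 := computePos.run n env A0 with hA1
  have p1 : IsVec A1 5 H.pos := hpos ▸ isVec_computePos hT h0 h2 hx hy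
  have d1 : IsMat A1 2 T.dist := h2.run rfl
  have x1 : A1 4 1 = x := by rw [hA1, Stmt.run_of_writes computePos rfl, hx]
  have y1 : A1 4 2 = y := by rw [hA1, Stmt.run_of_writes computePos rfl, hy]
  set A2 := computeHeight.run n env A1
  have e2 : IsVec A2 6 H.height := hheight ▸ isVec_computeHeight hT h0 d1 x1 y1
  have d2 : IsMat A2 2 T.dist := d1.run rfl
  set A3 := computeLen.run n env A2
  have l3 : IsVec A3 7 H.hairLen := isVec_computeLen H hh h0 d2 e2
  set A4 := computeReach.run n env A3
  have r4 : IsVec A4 8 reach := isVec_computeQuot (by decide) hlen h1 hb l3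
  have e4 : IsVec A4 6 H.height := (e2.run (c := computeLen) rfl).run rfl
  set A5 := computeOffset.run n env A4
  have o5 : IsVec A5 9 (fun w => H.height w / (4 * b)) :=
    isVec_computeQuot (by decide) hh h1 hb e4
  have p5 : IsVec A5 5 H.pos := (((p1.run (c := computeHeight) rfl).run (c := computeLen) rfl).run
    (c := computeReach) rfl).run rfl
  have r5 : IsVec A5 8 reach := r4.run rfl
  set A6 := computeDepth.run n env A5
  have c6 : IsVec A6 10 (combDepth H.pos reach n) := isVec_computeDepth hr p5 r5
  have b7 := isVec_computeBucket (b := b) (env := env) (height := H.height) hp hh h0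
    (p5.run (c := computeDepth) rfl) (r5.run (c := computeDepth) rfl)
    (o5.run (c := computeDepth) rfl) c6
  refine ⟨_, isVec_computeLayout b7, isLayout_rankLayout _, fun hbw => ?_⟩
  exact H.layoutBandwidth_le hT.connected hbw (fun w => (hh w).le) hb (fun _ => rfl)
    (fun w => (combDepth_succ_eq n (hr w)).symm)

/-- The registers that hold the input variables. -/
def inputReg (x : ℕ) : ℕ := if x = 1 then 1 else 0

/-- The whole algorithm: it computes a layout in array `1` and reports in variable `0` whether the
bandwidth of this layout is at most `48 * b ^ 3`. -/
def layoutProg : Prog :=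
  .seq (layoutStmt.compile inputReg 2) (.seq (checkTerm.compile inputReg 2) (.assign 0 (.var 2)))

theorem isMat_inputState (T : SimpleGraph (Fin n)) (b : ℕ) :
    IsMat (inputState T b).arr 0 (adjEntry T) := by
  intro u v
  simp only [inputState, adjEntry, true_and]
  congr 1
  rw [eq_iff_iff]
  constructor
  · rintro ⟨-, u', v', h, h'⟩
    obtain ⟨rfl, rfl⟩ := index_inj h'
    exact h
  · exact fun h => ⟨rfl, u, v, h, rfl⟩

theorem runs_layoutProg {X W : ℕ} (hT : IsCaterpillar T) (hb : 0 < b) (hX : 48 ≤ X)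
    (hnX : 8 * n ≤ X) (hbX : b ≤ X) (hW : X ≤ W) (hW1 : X ^ layoutStmt.deg ≤ W)
    (hW2 : X ^ checkTerm.deg ≤ W) :
    Runs W layoutProg (inputState T b) ((layoutStmt.size + (checkTerm.size + 2)) * n ^ 3) fun s =>
      (s.var 0 = 1 ∧ IsLayout (fun v : Fin n => s.arr 1 v) ∧
        layoutBandwidth T (fun v : Fin n => s.arr 1 v) ≤ 48 * b ^ 3) ∨
      (s.var 0 = 0 ∧ b < bandwidth T) := by
  have hn : 1 ≤ n := hT.1.connected.nonempty.some.pos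
  set s0 := inputState T b with hs0
  set env : ℕ → ℕ := s0.var ∘ inputReg with henv
  have h0 : env 0 = n := by simp [henv, inputReg, hs0, inputState]
  have h1 : env 1 = b := by simp [henv, inputReg, hs0, inputState]
  have hreg : ∀ x, inputReg x < 2 := fun x => by unfold inputReg; split_ifs <;> omega
  have henvX : ∀ x, s0.var (inputReg x) ≤ X := fun x => by
    unfold inputReg
    split_ifs <;> simp [hs0, inputState] <;> omega
  have harr : ∀ a i, s0.arr a i ≤ X := fun a i => by
    simp only [hs0, inputState]
    split_ifs <;> omega
  have hmat : IsMat s0.arr 0 (adjEntry T) := isMat_inputState T b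
  obtain ⟨α, hα, hlayout, hbw⟩ := exists_layout_layoutStmt hT hb h0 h1 hmat
  have hcheck := val_checkTerm (A := layoutStmt.run n env s0.arr) h0 h1 (hmat.run rfl) hα
  have hrun1 := layoutStmt.runs_compile (N := n) (by omega) hnX hn inputReg 2 s0 hreg
    (by simp [hs0, inputState]) harr henvX (show 4 ≤ X by omega) hW1 hW
  refine (Runs.seq hrun1 fun s1 hs1 => Runs.seq (Term.runs_compile (A := layoutStmt.run n env s0.arr)
    (N := n) (X := X) (by omega) (by omega) hn (layoutStmt.run_le hnX env _ harr) checkTerm inputReg 2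
    s1 hreg ?_ hs1.1 ?_ (show 48 ≤ X from hX) hW2) fun s2 hs2 =>
      Runs.assign (x := 0) (e := .var 2) ?_ ?_).mono ?_ fun _ h => h
  · rw [hs1.2 0 (by omega)]; simp [hs0, inputState]
  · intro x; rw [hs1.2 _ (hreg x)]; exact henvX x
  · simp only [Expr.Fits]
    have hcomp : s1.var ∘ inputReg = env := funext fun x => hs1.2 _ (hreg x)
    rw [hs2.2.2, hcomp, hcheck]
    split_ifs <;> omega
  · have hcomp : s1.var ∘ inputReg = env := funext fun x => hs1.2 _ (hreg x)
    have hval := hs2.2.2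
    rw [hcomp, hcheck] at hval
    have hα' : (fun v : Fin n => s2.arr 1 v) = α := funext fun v => by rw [hs2.1]; exact hα v
    simp only [Function.update_self, Expr.value, hα', hval]
    by_cases hc : layoutBandwidth T α ≤ 48 * b ^ 3
    · exact .inl ⟨if_pos hc, hlayout, hc⟩
    · exact .inr ⟨if_neg hc, lt_of_not_ge fun h => hc (hbw h)⟩
  · have e1 : layoutStmt.height = 3 := rfl
    have e2 : checkTerm.height = 2 := rfl
    rw [e1, e2]
    have h2 : n ^ 2 ≤ n ^ 3 := Nat.pow_le_pow_right hn (by omega)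
    have h3 : 1 ≤ n ^ 3 := Nat.one_le_pow _ _ hn
    have h4 := Nat.mul_le_mul_left checkTerm.size h2
    simp only [Expr.cost, Nat.add_mul]
    omega

end LoopLang

/-- There is a word RAM program (words of `O(log (n + b))` bits) that, given a caterpillar `T` with
`n` vertices and a positive integer `b`, stops after `O(b * n ^ 3)` steps and either answers `1` in
variable `0` and returns in array `1` a layout of `T` of bandwidth at most `48 * b ^ 3`, or answers
`0`, in which case the bandwidth of `T` exceeds `b`. -/
theorem mainTheorem5 :
    ∃ (P : WordRAM.Prog) (C : ℕ), ∀ (n b : ℕ) (T : SimpleGraph (Fin n)),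
      IsCaterpillar T → 0 < b →
        ∃ (t : ℕ) (s : WordRAM.State),
          WordRAM.Exec ((n + b + C) ^ C) P (WordRAM.inputState T b) t s ∧
          t ≤ C * (b * n ^ 3) ∧
          ((s.var 0 = 1 ∧ IsLayout (fun v : Fin n => s.arr 1 v) ∧
              layoutBandwidth T (fun v : Fin n => s.arr 1 v) ≤ 48 * b ^ 3) ∨
            (s.var 0 = 0 ∧ b < bandwidth T)) := by
  set D := max LoopLang.layoutStmt.deg LoopLang.checkTerm.deg with hD
  set S := LoopLang.layoutStmt.size + (LoopLang.checkTerm.size + 2) with hS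
  refine ⟨LoopLang.layoutProg, 8 + 2 * D + S, fun n b T hT hb => ?_⟩
  set C := 8 + 2 * D + S with hC
  set Y := n + b + C with hY
  -- All words are bounded by powers of `8 * n + b + 48`.
  have hXY : 8 * n + b + 48 ≤ Y ^ 2 := by nlinarith
  have hY1 : 1 ≤ Y := by omega
  have hpow : ∀ d ≤ D + 1, (8 * n + b + 48) ^ d ≤ Y ^ C := fun d hd => by
    calc (8 * n + b + 48) ^ d ≤ (Y ^ 2) ^ d := Nat.pow_le_pow_left hXY d
      _ = Y ^ (2 * d) := (pow_mul _ _ _).symm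
      _ ≤ Y ^ C := Nat.pow_le_pow_right hY1 (by omega)
  obtain ⟨t, s, hexec, ht, hs⟩ := LoopLang.runs_layoutProg (X := 8 * n + b + 48) (W := Y ^ C) hT hb
    (by omega) (by omega) (by omega) (by simpa using hpow 1 (by omega)) (hpow _ (by omega))
    (hpow _ (by omega))
  refine ⟨t, s, hexec, ht.trans ?_, hs⟩
  calc S * n ^ 3 ≤ C * n ^ 3 := Nat.mul_le_mul_right _ (by omega)
    _ ≤ C * (b * n ^ 3) := Nat.mul_le_mul_left _ (Nat.le_mul_of_pos_left _ hb)
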